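/- Let $(\Omega,\mathcal A,\mu)$ be a $\sigma$-finite measure space and let $p(\cdot):\Omega\to[1,\infty]$ be a measurable function with $p(x)<\infty$ for $\mu$-almost every $x$. For an exponent function $q(\cdot)$ (a measurable function $\Omega\to[1,\infty]$) put $\Omega_\infty^q=\{x: q(x)=\infty\}$ and, for measurable scalar-valued (real or complex) $f$, $$\rho_{q(\cdot)}(f)=\int_{\Omega\setminus\Omega^q_\infty}|f(x)|^{q(x)}\,d\mu(x)+\|f\|_{L^\infty(\Omega^q_\infty)},$$ and let $L^{q(\cdot)}$ be the space of (classes modulo equality almost everywhere of) measurable $f$ with $\rho_{q(\cdot)}(f/\lambda)<\infty$ for some $\lambda>0$, with the Luxemburg norm $\|f\|_{q(\cdot)}=\inf\{\lambda>0:\rho_{q(\cdot)}(f/\lambda)\le 1\}$. Let $p'(\cdot)$ be the dual exponent, $\frac1{p(x)}+\frac1{p'(x)}=1$ with $1/\infty=0$. For $E\subseteq\Omega$ let $p_+(E)=\operatorname{ess\,sup}_{x\in E}p(x)$, and $p_+=p_+(\Omega)$. Let $L^{p(\cdot)}_b=\{f\in L^{p(\cdot)}: p_+(\operatorname{supp}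 f)<\infty\}$, where $\operatorname{supp} f=\{x : f(x)\neq0\}$, and let $L^{p(\cdot)}_{\mathrm{germ}}=L^{p(\cdot)}/\overline{L^{p(\cdot)}_b}$, where the closure is taken in $L^{p(\cdot)}$, with the quotient norm. **Theorem 2.1.** If $p_+=\infty$, then the dual space $(L^{p(\cdot)})^*$ is isomorphic (that is, linearly homeomorphic) to the external direct sum $L^{p'(\cdot)}\oplus(L^{p(\cdot)}_{\mathrm{germ}})^*$. -/

import Mathlib

open MeasureTheory
open scoped ENNReal

noncomputable section

namespace VarLp

/-- An exponent function: a measurable function `p : Ω → [1, ∞]`. -/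
structure Exponent (Ω : Type*) [MeasurableSpace Ω] where
  toFun : Ω → ℝ≥0∞
  measurable_toFun : Measurable toFun
  one_le : ∀ x, 1 ≤ toFun x

variable {Ω : Type*} [MeasurableSpace Ω]

instance Exponent.instCoeFun : CoeFun (Exponent Ω) fun _ => Ω → ℝ≥0∞ := ⟨Exponent.toFun⟩

namespace Exponent

/-- The dual exponent `p'`, determined pointwise by `1 / p x + 1 / p' x = 1` with `1 / ∞ = 0`. -/
def conj (p : Exponent Ω) : Exponent Ω where
  toFun x := ENNReal.conjExponent (p x)
  measurable_toFun :=
    measurable_const.add ((p.measurable_toFun.sub measurable_const).inv)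
  one_le _ := le_self_add

theorem inv_add_inv_conj (p : Exponent Ω) (x : Ω) : (p x)⁻¹ + (p.conj x)⁻¹ = 1 :=
  (ENNReal.HolderConjugate.conjExponent (p.one_le x)).inv_add_inv_eq_one

/-- `Ω_∞ = {x : p x = ∞}`. -/
def infSet (p : Exponent Ω) : Set Ω := {x | p x = ∞}

theorem measurableSet_infSet (p : Exponent Ω) : MeasurableSet p.infSet :=
  p.measurable_toFun (measurableSet_singleton ∞)

/-- `p₊(E)`, the essential supremum of the exponent over `E`. -/
def pPlus (p : Exponent Ω) (μ : Measure Ω) (E : Set Ω) : ℝ≥0∞ := essSup p (μ.restrict E)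

end Exponent

variable {𝕜 : Type*} [RCLike 𝕜]

/-- The modular: the integral of `|f x| ^ p x` over `Ω \ Ω_∞` plus the `L^∞` norm of `f` on
`Ω_∞`. -/
def modular (p : Exponent Ω) (μ : Measure Ω) (f : Ω → 𝕜) : ℝ≥0∞ :=
  (∫⁻ x in p.infSetᶜ, ‖f x‖ₑ ^ (p x).toReal ∂μ) +
    essSup (fun x => ‖f x‖ₑ) (μ.restrict p.infSet)

section modular

variable {p : Exponent Ω} {μ : Measure Ω}

theorem modular_mono_ae {f g : Ω → 𝕜} (h : ∀ᵐ x ∂μ, ‖f x‖ₑ ≤ ‖g x‖ₑ) :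
    modular p μ f ≤ modular p μ g := by
  refine add_le_add (lintegral_mono_ae ?_) (essSup_mono_ae (ae_restrict_of_ae h))
  filter_upwards [ae_restrict_of_ae h] with x hx
  exact ENNReal.rpow_le_rpow hx ENNReal.toReal_nonneg

theorem modular_congr_ae {f g : Ω → 𝕜} (h : f =ᵐ[μ] g) : modular p μ f = modular p μ g :=
  le_antisymm (modular_mono_ae (h.mono fun x hx => by rw [hx]))
    (modular_mono_ae (h.mono fun x hx => by rw [hx]))

theorem one_le_toReal {x : Ω} (hx : x ∈ p.infSetᶜ) : 1 ≤ (p x).toReal := by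
  have : p x ≠ ∞ := hx
  simpa using (ENNReal.toReal_le_toReal ENNReal.one_ne_top this).2 (p.one_le x)

theorem modular_zero : modular p μ (fun _ => (0 : 𝕜)) = 0 := by
  have h1 : ∫⁻ x in p.infSetᶜ, ‖(0 : 𝕜)‖ₑ ^ (p x).toReal ∂μ = 0 := by
    rw [setLIntegral_congr_fun (g := fun _ => 0) p.measurableSet_infSet.compl]
    · simp
    · intro x hx
      have := one_le_toReal hx
      simp only [enorm_zero]
      exact ENNReal.zero_rpow_of_pos (by linarith)
  have h2 : essSup (fun _ => ‖(0 : 𝕜)‖ₑ) (μ.restrict p.infSet) = 0 := by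
    simpa using essSup_const_bot (μ := μ.restrict p.infSet) (β := ℝ≥0∞)
  rw [modular, h1, h2, add_zero]

/-- The modular is convex. -/
theorem modular_convex {f g : Ω → 𝕜} (hf : AEStronglyMeasurable f μ) {s t : ℝ}
    (hs : 0 ≤ s) (ht : 0 ≤ t) (hst : s + t = 1) :
    modular p μ (fun x => (s : 𝕜) * f x + (t : 𝕜) * g x) ≤
      ENNReal.ofReal s * modular p μ f + ENNReal.ofReal t * modular p μ g := by
  have hsum : ENNReal.ofReal s + ENNReal.ofReal t = 1 := by
    rw [← ENNReal.ofReal_add hs ht, hst, ENNReal.ofReal_one]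
  have hpt : ∀ x, ‖(s : 𝕜) * f x + (t : 𝕜) * g x‖ₑ ≤
      ENNReal.ofReal s * ‖f x‖ₑ + ENNReal.ofReal t * ‖g x‖ₑ := by
    intro x
    refine (enorm_add_le _ _).trans (le_of_eq ?_)
    have key : ∀ r : ℝ, 0 ≤ r → ‖(r : 𝕜)‖ₑ = ENNReal.ofReal r := by
      intro r hr
      rw [← ofReal_norm, RCLike.norm_of_nonneg hr]
    rw [enorm_mul, enorm_mul, key s hs, key t ht]
  have h1 : ∫⁻ x in p.infSetᶜ, ‖(s : 𝕜) * f x + (t : 𝕜) * g x‖ₑ ^ (p x).toReal ∂μ ≤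
      ENNReal.ofReal s * (∫⁻ x in p.infSetᶜ, ‖f x‖ₑ ^ (p x).toReal ∂μ) +
      ENNReal.ofReal t * (∫⁻ x in p.infSetᶜ, ‖g x‖ₑ ^ (p x).toReal ∂μ) := by
    rw [← lintegral_const_mul' _ _ ENNReal.ofReal_ne_top,
      ← lintegral_const_mul' _ _ ENNReal.ofReal_ne_top, ← lintegral_add_left']
    · refine setLIntegral_mono' p.measurableSet_infSet.compl fun x hx => ?_
      have h1p := one_le_toReal hx
      refine (ENNReal.rpow_le_rpow (hpt x) (by linarith)).trans ?_
      exact ENNReal.rpow_arith_mean_le_arith_mean2_rpow _ _ _ _ hsum h1p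
    · exact ((hf.enorm.restrict).pow
        (p.measurable_toFun.ennreal_toReal.aemeasurable)).const_mul _
  have h2 : essSup (fun x => ‖(s : 𝕜) * f x + (t : 𝕜) * g x‖ₑ) (μ.restrict p.infSet) ≤
      ENNReal.ofReal s * essSup (fun x => ‖f x‖ₑ) (μ.restrict p.infSet) +
      ENNReal.ofReal t * essSup (fun x => ‖g x‖ₑ) (μ.restrict p.infSet) := by
    refine essSup_le_of_ae_le _ ?_
    filter_upwards [ENNReal.ae_le_essSup (μ := μ.restrict p.infSet) fun x => ‖f x‖ₑ,
      ENNReal.ae_le_essSup (μ := μ.restrict p.infSet) fun x => ‖g x‖ₑ] with x hx hy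
    refine (hpt x).trans ?_
    gcongr
  refine (add_le_add h1 h2).trans (le_of_eq ?_)
  rw [modular, modular]
  ring

theorem modular_mul_le {f : Ω → 𝕜} (hf : AEStronglyMeasurable f μ) {s : ℝ}
    (hs : 0 ≤ s) (hs1 : s ≤ 1) :
    modular p μ (fun x => (s : 𝕜) * f x) ≤ ENNReal.ofReal s * modular p μ f := by
  have h := modular_convex (p := p) (g := fun _ => (0 : 𝕜)) hf hs (sub_nonneg.2 hs1) (by ring)
  simpa [modular_zero] using h

theorem modular_norm_congr {f g : Ω → 𝕜} (h : ∀ᵐ x ∂μ, ‖f x‖ = ‖g x‖) :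
    modular p μ f = modular p μ g := by
  have h' : ∀ᵐ x ∂μ, ‖f x‖ₑ = ‖g x‖ₑ := h.mono fun x hx => by
    rw [← ofReal_norm, hx, ofReal_norm]
  exact le_antisymm (modular_mono_ae (h'.mono fun x hx => hx.le))
    (modular_mono_ae (h'.mono fun x hx => hx.ge))

theorem ae_eq_zero_of_modular_eq_zero {f : Ω → 𝕜} (hf : AEStronglyMeasurable f μ)
    (h : modular p μ f = 0) : f =ᵐ[μ] 0 := by
  rw [modular, add_eq_zero] at h
  obtain ⟨h1, h2⟩ := h
  have h1' : ∀ᵐ x ∂μ.restrict p.infSetᶜ, f x = 0 := by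
    rw [lintegral_eq_zero_iff' ((hf.enorm.restrict).pow
        (p.measurable_toFun.ennreal_toReal.aemeasurable))] at h1
    filter_upwards [h1, ae_restrict_mem p.measurableSet_infSet.compl] with x hx hm
    have := one_le_toReal hm
    have h0 : ‖f x‖ₑ = 0 := (ENNReal.rpow_eq_zero_iff_of_pos (by linarith)).1 hx
    simpa using h0
  have h2' : ∀ᵐ x ∂μ.restrict p.infSet, f x = 0 := by
    filter_upwards [ENNReal.essSup_eq_zero_iff.1 h2] with x hx
    simpa using hx
  have := (ae_restrict_iff' p.measurableSet_infSet).1 h2'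
  have h3 := (ae_restrict_iff' p.measurableSet_infSet.compl).1 h1'
  filter_upwards [this, h3] with x hx hy
  by_cases hm : x ∈ p.infSet
  · exact hx hm
  · exact hy hm

end modular

/-- The numbers `l > 0` with `modular (f / l) ≤ 1`. -/
def luxSet (p : Exponent Ω) (μ : Measure Ω) (f : Ω → 𝕜) : Set ℝ :=
  {l | 0 < l ∧ modular p μ (fun x => f x / (l : 𝕜)) ≤ 1}

/-- Membership in `L^{p(·)}`: `modular (f / l) < ∞` for some `l > 0`. -/
def MemVLp (p : Exponent Ω) (μ : Measure Ω) (f : Ω → 𝕜) : Prop :=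
  ∃ l : ℝ, 0 < l ∧ modular p μ (fun x => f x / (l : 𝕜)) < ∞

/-- The Luxemburg norm `inf {l > 0 : modular (f / l) ≤ 1}`. -/
def luxNorm (p : Exponent Ω) (μ : Measure Ω) (f : Ω → 𝕜) : ℝ := sInf (luxSet p μ f)

section lux

variable {p : Exponent Ω} {μ : Measure Ω}

theorem luxSet_bddBelow (f : Ω → 𝕜) : BddBelow (luxSet p μ f) := ⟨0, fun _ h => h.1.le⟩

theorem luxNorm_nonneg (f : Ω → 𝕜) : 0 ≤ luxNorm p μ f :=
  Real.sInf_nonneg fun _ h => h.1.le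

theorem luxSet_congr {f g : Ω → 𝕜} (h : f =ᵐ[μ] g) : luxSet p μ f = luxSet p μ g := by
  ext l
  have : modular p μ (fun x => f x / (l : 𝕜)) = modular p μ (fun x => g x / (l : 𝕜)) :=
    modular_congr_ae (h.mono fun x hx => by simp only [hx])
  simp only [luxSet, Set.mem_ofPred_eq, this]

theorem luxNorm_congr {f g : Ω → 𝕜} (h : f =ᵐ[μ] g) : luxNorm p μ f = luxNorm p μ g := by
  rw [luxNorm, luxNorm, luxSet_congr h]

theorem memVLp_iff {f : Ω → 𝕜} (hf : AEStronglyMeasurable f μ) :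
    MemVLp p μ f ↔ (luxSet p μ f).Nonempty := by
  constructor
  · rintro ⟨l, hl, hfin⟩
    set M := (modular p μ (fun x => f x / (l : 𝕜))).toReal with hM
    have hM0 : 0 ≤ M := ENNReal.toReal_nonneg
    have hc : 0 < M + 1 := by linarith
    refine ⟨l * (M + 1), by positivity, ?_⟩
    have h := modular_mul_le (p := p) (hf.mul_const ((l : 𝕜)⁻¹)) (s := (M + 1)⁻¹) (by positivity)
      (inv_le_one_of_one_le₀ (by linarith))
    have he : (fun x => f x / ((l * (M + 1) : ℝ) : 𝕜)) =
        fun x => (((M + 1)⁻¹ : ℝ) : 𝕜) * (f x * (l : 𝕜)⁻¹) := by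
      funext x
      push_cast
      rw [div_eq_mul_inv, mul_inv]
      ring
    rw [he]
    refine h.trans ?_
    have : modular p μ (fun x => f x * (l : 𝕜)⁻¹) = ENNReal.ofReal M := by
      rw [hM, ENNReal.ofReal_toReal hfin.ne]
      simp only [div_eq_mul_inv]
    rw [this, ← ENNReal.ofReal_mul (by positivity), ← ENNReal.ofReal_one]
    refine ENNReal.ofReal_le_ofReal ?_
    rw [inv_mul_le_iff₀ hc]
    linarith
  · rintro ⟨l, hl, h⟩
    exact ⟨l, hl, h.trans_lt ENNReal.one_lt_top⟩

theorem add_mem_luxSet {f g : Ω → 𝕜} (hf : AEStronglyMeasurable f μ) {a b : ℝ}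
    (ha : a ∈ luxSet p μ f) (hb : b ∈ luxSet p μ g) :
    a + b ∈ luxSet p μ (fun x => f x + g x) := by
  obtain ⟨ha0, ha⟩ := ha
  obtain ⟨hb0, hb⟩ := hb
  have hab : 0 < a + b := by linarith
  refine ⟨hab, ?_⟩
  have hs : (0 : ℝ) ≤ a / (a + b) := by positivity
  have ht : (0 : ℝ) ≤ b / (a + b) := by positivity
  have hst : a / (a + b) + b / (a + b) = 1 := by field_simp
  have h := modular_convex (p := p) (g := fun x => g x / (b : 𝕜))
    (hf.mul_const ((a : 𝕜)⁻¹)) hs ht hst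
  have he : (fun x => (f x + g x) / ((a + b : ℝ) : 𝕜)) =
      fun x => ((a / (a + b) : ℝ) : 𝕜) * (f x * (a : 𝕜)⁻¹) +
        ((b / (a + b) : ℝ) : 𝕜) * (g x / (b : 𝕜)) := by
    funext x
    have h1 : (a : 𝕜) ≠ 0 := by exact_mod_cast ha0.ne'
    have h2 : (b : 𝕜) ≠ 0 := by exact_mod_cast hb0.ne'
    have h3 : (a : 𝕜) + (b : 𝕜) ≠ 0 := by exact_mod_cast hab.ne'
    push_cast
    field_simp
  rw [he]
  refine h.trans ?_
  have ha' : modular p μ (fun x => f x * (a : 𝕜)⁻¹) ≤ 1 := by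
    simpa only [div_eq_mul_inv] using ha
  calc _ ≤ ENNReal.ofReal (a / (a + b)) * 1 + ENNReal.ofReal (b / (a + b)) * 1 := by gcongr
    _ = 1 := by
      rw [mul_one, mul_one, ← ENNReal.ofReal_add hs ht, hst, ENNReal.ofReal_one]

theorem mul_mem_luxSet {f : Ω → 𝕜} {a : ℝ} (ha : a ∈ luxSet p μ f) {c : 𝕜} (hc : c ≠ 0) :
    ‖c‖ * a ∈ luxSet p μ (fun x => c * f x) := by
  have hc' : 0 < ‖c‖ := norm_pos_iff.2 hc
  refine ⟨mul_pos hc' ha.1, ?_⟩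
  refine (modular_norm_congr (Filter.Eventually.of_forall fun x => ?_)).trans_le ha.2
  have := ha.1
  simp only [norm_div, norm_mul, RCLike.norm_ofReal, abs_norm, abs_mul]
  field_simp

theorem luxSet_zero_mem {l : ℝ} (hl : 0 < l) : l ∈ luxSet p μ (fun _ : Ω => (0 : 𝕜)) := by
  refine ⟨hl, ?_⟩
  simp [modular_zero]

theorem luxNorm_zero : luxNorm p μ (fun _ : Ω => (0 : 𝕜)) = 0 := by
  refine le_antisymm (le_of_forall_pos_le_add fun e he => ?_) (luxNorm_nonneg _)
  rw [zero_add]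
  exact csInf_le (luxSet_bddBelow _) (luxSet_zero_mem he)

theorem mem_luxSet_of_le {f : Ω → 𝕜} {a b : ℝ} (ha : a ∈ luxSet p μ f) (hab : a ≤ b) :
    b ∈ luxSet p μ f := by
  have ha0 := ha.1
  have hb0 : 0 < b := ha0.trans_le hab
  refine ⟨hb0, le_trans (modular_mono_ae (Filter.Eventually.of_forall fun x => ?_)) ha.2⟩
  rw [← ofReal_norm, ← ofReal_norm]
  refine ENNReal.ofReal_le_ofReal ?_
  rw [norm_div, norm_div, RCLike.norm_of_nonneg ha0.le, RCLike.norm_of_nonneg hb0.le]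
  gcongr

theorem ae_eq_zero_of_luxNorm_eq_zero {f : Ω → 𝕜} (hf : AEStronglyMeasurable f μ)
    (hm : MemVLp p μ f) (h : luxNorm p μ f = 0) : f =ᵐ[μ] 0 := by
  have hne := (memVLp_iff hf).1 hm
  refine ae_eq_zero_of_modular_eq_zero (p := p) hf ?_
  have hsmall : ∀ e : ℝ, 0 < e → e < 1 → modular p μ f ≤ ENNReal.ofReal e := by
    intro e he he1
    obtain ⟨a, ha, hae⟩ := exists_lt_of_csInf_lt hne (show luxNorm p μ f < e by rw [h]; exact he)
    have hem := mem_luxSet_of_le ha hae.le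
    have h1 := modular_mul_le (p := p) (hf.mul_const ((e : 𝕜)⁻¹)) he.le he1.le
    have he0 : (e : 𝕜) ≠ 0 := by exact_mod_cast he.ne'
    have heq : (fun x => (e : 𝕜) * (f x * (e : 𝕜)⁻¹)) = f := by
      funext x
      field_simp
    rw [heq] at h1
    refine h1.trans ?_
    have h2 : modular p μ (fun x => f x * (e : 𝕜)⁻¹) ≤ 1 := by
      simpa only [div_eq_mul_inv] using hem.2
    simpa using mul_le_mul_right h2 (ENNReal.ofReal e)
  refine le_antisymm (ENNReal.le_of_forall_pos_le_add fun e he _ => ?_) bot_le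
  have hm0 : (0 : ℝ) < min e (1 / 2) := lt_min (by exact_mod_cast he) (by norm_num)
  refine (hsmall _ hm0 ((min_le_right _ _).trans_lt (by norm_num))).trans ?_
  rw [zero_add]
  exact (ENNReal.ofReal_le_ofReal (min_le_left _ _)).trans (by simp)

end lux

variable (𝕜) in
/-- The functions in `L^{p(·)}`, modulo equality almost everywhere, as a subspace of the space of
all measurable functions modulo equality almost everywhere. -/
def vLpSubmodule (p : Exponent Ω) (μ : Measure Ω) : Submodule 𝕜 (Ω →ₘ[μ] 𝕜) where
  carrier := {f | MemVLp p μ f}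
  zero_mem' := by
    have h := AEEqFun.coeFn_zero (μ := μ) (α := Ω) (β := 𝕜)
    rw [Set.mem_ofPred_eq, memVLp_iff (AEEqFun.aestronglyMeasurable _), luxSet_congr h]
    exact ⟨1, luxSet_zero_mem one_pos⟩
  add_mem' := by
    intro f g hf hg
    rw [Set.mem_ofPred_eq, memVLp_iff (AEEqFun.aestronglyMeasurable _)] at *
    obtain ⟨a, ha⟩ := hf
    obtain ⟨b, hb⟩ := hg
    rw [luxSet_congr (AEEqFun.coeFn_add f g)]
    exact ⟨a + b, add_mem_luxSet f.aestronglyMeasurable ha hb⟩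
  smul_mem' := by
    intro c f hf
    rw [Set.mem_ofPred_eq, memVLp_iff (AEEqFun.aestronglyMeasurable _)] at *
    obtain ⟨a, ha⟩ := hf
    rw [luxSet_congr (AEEqFun.coeFn_smul c f)]
    by_cases hc : c = 0
    · subst hc
      have : ((0 : 𝕜) • (f : Ω → 𝕜)) = fun _ => 0 := by funext x; simp
      rw [this]
      exact ⟨1, luxSet_zero_mem one_pos⟩
    · exact ⟨‖c‖ * a, mul_mem_luxSet ha hc⟩

variable (𝕜) in
/-- The variable Lebesgue space `L^{p(·)}` of `𝕜`-valued functions modulo equality almost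
everywhere. It is the subspace above, and is given the Luxemburg norm below. -/
def VLp (p : Exponent Ω) (μ : Measure Ω) : Type _ := vLpSubmodule 𝕜 p μ

section norm

variable {p : Exponent Ω} {μ : Measure Ω}

instance VLp.instAddCommGroup : AddCommGroup (VLp 𝕜 p μ) := inferInstanceAs (AddCommGroup (vLpSubmodule 𝕜 p μ))

instance VLp.instModule : Module 𝕜 (VLp 𝕜 p μ) := inferInstanceAs (Module 𝕜 (vLpSubmodule 𝕜 p μ))

/-- The underlying class of measurable functions modulo equality almost everywhere. -/
def VLp.toAEEqFun (f : VLp 𝕜 p μ) : Ω →ₘ[μ] 𝕜 := f.1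

instance VLp.instCoeFun : CoeFun (VLp 𝕜 p μ) fun _ => Ω → 𝕜 := ⟨fun f => f.toAEEqFun⟩

theorem VLp.memVLp (f : VLp 𝕜 p μ) : MemVLp p μ f := f.2

theorem VLp.aestronglyMeasurable (f : VLp 𝕜 p μ) : AEStronglyMeasurable f μ :=
  f.toAEEqFun.aestronglyMeasurable

theorem VLp.ext {f g : VLp 𝕜 p μ} (h : f =ᵐ[μ] g) : f = g := Subtype.ext (AEEqFun.ext h)

theorem VLp.coeFn_zero : ((0 : VLp 𝕜 p μ) : Ω → 𝕜) =ᵐ[μ] fun _ => 0 := AEEqFun.coeFn_zero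

theorem VLp.coeFn_add (f g : VLp 𝕜 p μ) : (f + g : VLp 𝕜 p μ) =ᵐ[μ] fun x => f x + g x :=
  AEEqFun.coeFn_add f.toAEEqFun g.toAEEqFun

theorem VLp.coeFn_smul (c : 𝕜) (f : VLp 𝕜 p μ) : (c • f : VLp 𝕜 p μ) =ᵐ[μ] fun x => c * f x :=
  AEEqFun.coeFn_smul c f.toAEEqFun

theorem luxSet_nonempty (f : VLp 𝕜 p μ) : (luxSet p μ f).Nonempty :=
  (memVLp_iff f.aestronglyMeasurable).1 f.memVLp

theorem luxNorm_smul_le (c : 𝕜) (f : VLp 𝕜 p μ) :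
    luxNorm p μ (c • f : VLp 𝕜 p μ) ≤ ‖c‖ * luxNorm p μ f := by
  have h0 : luxNorm p μ (c • f : VLp 𝕜 p μ) =
      luxNorm p μ (fun x => c * f x) :=
    luxNorm_congr (VLp.coeFn_smul c f)
  rw [h0]
  by_cases hc : c = 0
  · subst hc
    simp [luxNorm_zero]
  · have hc' : 0 < ‖c‖ := norm_pos_iff.2 hc
    rw [← div_le_iff₀' hc']
    refine le_csInf (luxSet_nonempty f) fun a ha => ?_
    rw [div_le_iff₀' hc']
    exact csInf_le (luxSet_bddBelow _) (mul_mem_luxSet ha hc)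

theorem luxNorm_add_le (f g : VLp 𝕜 p μ) :
    luxNorm p μ (f + g : VLp 𝕜 p μ) ≤
      luxNorm p μ f + luxNorm p μ g := by
  have h0 : luxNorm p μ (f + g : VLp 𝕜 p μ) =
      luxNorm p μ (fun x => f x + g x) :=
    luxNorm_congr (VLp.coeFn_add f g)
  rw [h0]
  refine le_of_forall_pos_le_add fun e he => ?_
  obtain ⟨a, ha, hae⟩ := exists_lt_of_csInf_lt (luxSet_nonempty f)
    (show luxNorm p μ f < luxNorm p μ f + e / 2 by linarith)
  obtain ⟨b, hb, hbe⟩ := exists_lt_of_csInf_lt (luxSet_nonempty g)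
    (show luxNorm p μ g < luxNorm p μ g + e / 2 by linarith)
  have := csInf_le (luxSet_bddBelow _)
    (add_mem_luxSet f.aestronglyMeasurable ha hb)
  rw [luxNorm]
  linarith

/-- `L^{p(·)}` with the Luxemburg norm. -/
instance VLp.instNormedAddCommGroup : NormedAddCommGroup (VLp 𝕜 p μ) :=
  AddGroupNorm.toNormedAddCommGroup
    { toFun := fun f => luxNorm p μ f
      map_zero' := (luxNorm_congr VLp.coeFn_zero).trans luxNorm_zero
      add_le' := luxNorm_add_le
      neg' := fun f => by
        have h : ∀ g : VLp 𝕜 p μ, luxNorm p μ (-g : VLp 𝕜 p μ) ≤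
            luxNorm p μ g := fun g => by
          have h1 := luxNorm_smul_le (-1 : 𝕜) g
          rwa [neg_one_smul, norm_neg, norm_one, one_mul] at h1
        exact le_antisymm (h f) (by have h2 := h (-f); rwa [neg_neg] at h2)
      eq_zero_of_map_eq_zero' := fun f hf =>
        VLp.ext ((ae_eq_zero_of_luxNorm_eq_zero f.aestronglyMeasurable f.memVLp hf).trans
          VLp.coeFn_zero.symm) }

theorem norm_def (f : VLp 𝕜 p μ) : ‖f‖ = luxNorm p μ f := rfl

instance VLp.instNormedSpace : NormedSpace 𝕜 (VLp 𝕜 p μ) where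
  norm_smul_le := luxNorm_smul_le

end norm

variable (𝕜) in
/-- `L^{p(·)}_b`: the functions in `L^{p(·)}` whose support `{x : f x ≠ 0}` is
`p(·)`-bounded. -/
def VLpBdd (p : Exponent Ω) (μ : Measure Ω) : Submodule 𝕜 (VLp 𝕜 p μ) where
  carrier := {f | p.pPlus μ (Function.support f) < ∞}
  zero_mem' := by
    have h : μ (Function.support (0 : VLp 𝕜 p μ)) = 0 := by
      exact VLp.coeFn_zero (𝕜 := 𝕜) (p := p) (μ := μ)
    have h' : μ.restrict (Function.support (0 : VLp 𝕜 p μ)) = 0 :=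
      Measure.restrict_eq_zero.2 h
    change essSup p (μ.restrict (Function.support (0 : VLp 𝕜 p μ))) < ∞
    rw [h']
    simp
  add_mem' := by
    intro f g hf hg
    let F : Ω → 𝕜 := f
    let G : Ω → 𝕜 := g
    have hF : ∀ᵐ x ∂μ.restrict (Function.support F), p x ≤ p.pPlus μ (Function.support F) :=
      ENNReal.ae_le_essSup _
    have hG : ∀ᵐ x ∂μ.restrict (Function.support G), p x ≤ p.pPlus μ (Function.support G) :=
      ENNReal.ae_le_essSup _
    have hle : p.pPlus μ (Function.support
        (f + g : VLp 𝕜 p μ)) ≤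
        max (p.pPlus μ (Function.support F)) (p.pPlus μ (Function.support G)) := by
      refine essSup_le_of_ae_le _ ?_
      have hsub : (Function.support (f + g : VLp 𝕜 p μ)) ≤ᵐ[μ]
          (Function.support F ∪ Function.support G : Set Ω) := by
        filter_upwards [VLp.coeFn_add f g] with x hx hm
        by_contra hcon
        have hcon' : ¬(F x ≠ 0 ∨ G x ≠ 0) := hcon
        push Not at hcon'
        refine hm ?_
        exact hx.trans (by change F x + G x = 0; rw [hcon'.1, hcon'.2, add_zero])
      refine ae_mono (Measure.restrict_mono_ae hsub) ?_
      refine (ae_restrict_union_iff _ _ _).2 ⟨?_, ?_⟩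
      · filter_upwards [hF] with x hx using hx.trans (le_max_left _ _)
      · filter_upwards [hG] with x hx using hx.trans (le_max_right _ _)
    exact hle.trans_lt (max_lt hf hg)
  smul_mem' := by
    intro c f hf
    have hsub : (Function.support (c • f : VLp 𝕜 p μ)) ≤ᵐ[μ]
        (Function.support (f : Ω → 𝕜)) := by
      filter_upwards [VLp.coeFn_smul c f] with x hx hm h0
      refine hm ?_
      exact hx.trans (by
        change c * f x = 0
        rw [h0, mul_zero])
    have hf' : p.pPlus μ (Function.support f) < ∞ := hf
    refine lt_of_le_of_lt ?_ hf'
    exact essSup_mono_measure' (Measure.restrict_mono_ae hsub)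

variable (𝕜) in
/-- The germ space `L^{p(·)}_germ`: the quotient of `L^{p(·)}` by the closure of `L^{p(·)}_b`,
with the quotient norm. -/
abbrev Germ (p : Exponent Ω) (μ : Measure Ω) : Type _ :=
  VLp 𝕜 p μ ⧸ (VLpBdd 𝕜 p μ).topologicalClosure

end VarLp

end

noncomputable section

namespace VarLp

variable {Ω : Type*} [MeasurableSpace Ω] {𝕜 : Type*} [RCLike 𝕜] {p : Exponent Ω} {μ : Measure Ω}

open Filter Topology NNReal

/-! ### Basic facts on the modular and the norm -/

/-! Write X for `L^{p(·)}` and B for the closure of `L^{p(·)}_b`. Functionals that vanish on B are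
exactly the functionals on the germ space, so the question is what a functional does on B. There it
is integration against some g in `L^{p'(·)}`, and by Hölder the same integral defines a bounded
functional on all of X. This integral is a canonical extension from B to X, and it splits off the
germ part: φ minus integration against g vanishes on B and descends to the quotient.

The representation on B rests on order continuity. Call a dominating function D good if every
multiple of D has finite modular; almost everywhere convergence dominated by such a D is norm
convergence (`VLp.tendsto_of_dominated`). Two kinds of good D occur: |f| for f in `L^{p(·)}_b`, and
a strictly positive weight w that exists by σ-finiteness (`exists_pos_finiteModular`). Using w, the
set function E ↦ φ(w 1_E) is countably additive and has a Radon-Nikodym density G, and g = G / w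
represents φ first on functions dominated by a multiple of w, then on B by truncation.

That g lies in `L^{p'(·)}` with norm at most 3‖φ‖ (`RepresentedBy.mem_luxSet`) comes from testing φ
on truncations of |g / 3M|^(p' - 1) times the conjugate phase of g, where M > 0 and M ≥ ‖φ‖. The
same estimate bounds g by the functional assembled from g and a germ functional, hence bounds the
germ part too, so the inverse map is continuous. -/

theorem modular_eq_lintegral (hfin : μ p.infSet = 0) (f : Ω → 𝕜) :
    modular p μ f = ∫⁻ x, ‖f x‖ₑ ^ (p x).toReal ∂μ := by
  have h1 : μ.restrict p.infSet = 0 := Measure.restrict_eq_zero.2 hfin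
  have h2 : μ.restrict p.infSetᶜ = μ :=
    Measure.restrict_eq_self_of_ae_mem (measure_eq_zero_iff_ae_notMem.1 hfin)
  rw [modular, h1, h2, essSup_measure_zero, _root_.bot_eq_zero, add_zero]

theorem ae_lt_top (hfin : μ p.infSet = 0) : ∀ᵐ x ∂μ, p x < ∞ := by
  filter_upwards [measure_eq_zero_iff_ae_notMem.1 hfin] with x hx
  exact lt_top_iff_ne_top.2 hx

theorem Exponent.one_le_toReal_of_ne_top {x : Ω} (hx : p x ≠ ∞) : 1 ≤ (p x).toReal :=
  one_le_toReal hx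

theorem ae_one_le_toReal (hfin : μ p.infSet = 0) : ∀ᵐ x ∂μ, 1 ≤ (p x).toReal := by
  filter_upwards [ae_lt_top hfin] with x hx using Exponent.one_le_toReal_of_ne_top hx.ne

theorem luxNorm_le_of_mem {f : Ω → 𝕜} {a : ℝ} (ha : a ∈ luxSet p μ f) : luxNorm p μ f ≤ a :=
  csInf_le (luxSet_bddBelow f) ha

theorem VLp.mem_luxSet_of_norm_lt (f : VLp 𝕜 p μ) {a : ℝ} (ha : ‖f‖ < a) :
    a ∈ luxSet p μ f := by
  obtain ⟨b, hb, hba⟩ := exists_lt_of_csInf_lt (luxSet_nonempty f) (show luxNorm p μ f < a from ha)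
  exact mem_luxSet_of_le hb hba.le

theorem enorm_div_ofReal (z : 𝕜) {l : ℝ} (hl : 0 < l) :
    ‖z / (l : 𝕜)‖ₑ = ENNReal.ofReal l⁻¹ * ‖z‖ₑ := by
  rw [← ofReal_norm, ← ofReal_norm, ← ENNReal.ofReal_mul (by positivity), norm_div,
    RCLike.norm_of_nonneg hl.le, div_eq_inv_mul]

/-- The element of `L^{p(·)}` given by a function. -/
def VLp.mk (f : Ω → 𝕜) (hf : AEStronglyMeasurable f μ) (hm : MemVLp p μ f) : VLp 𝕜 p μ :=
  ⟨AEEqFun.mk f hf, by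
    change MemVLp p μ (AEEqFun.mk f hf)
    rw [memVLp_iff (AEEqFun.aestronglyMeasurable _), luxSet_congr (AEEqFun.coeFn_mk f hf)]
    exact (memVLp_iff hf).1 hm⟩

theorem VLp.coeFn_mk (f : Ω → 𝕜) (hf : AEStronglyMeasurable f μ) (hm : MemVLp p μ f) :
    (VLp.mk f hf hm : Ω → 𝕜) =ᵐ[μ] f := AEEqFun.coeFn_mk f hf

theorem VLp.coeFn_sub (f g : VLp 𝕜 p μ) : (f - g : VLp 𝕜 p μ) =ᵐ[μ] fun x => f x - g x :=
  AEEqFun.coeFn_sub f.toAEEqFun g.toAEEqFun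

theorem VLp.norm_mk_le {f : Ω → 𝕜} (hf : AEStronglyMeasurable f μ) (hm : MemVLp p μ f) {a : ℝ}
    (ha : a ∈ luxSet p μ f) : ‖VLp.mk f hf hm‖ ≤ a := by
  rw [norm_def, luxNorm_congr (VLp.coeFn_mk f hf hm)]
  exact luxNorm_le_of_mem ha

/-! ### Hölder's inequality -/

theorem Exponent.conj_apply_of_eq_one {x : Ω} (h : p x = 1) : p.conj x = ∞ := by
  change ENNReal.conjExponent (p x) = ∞
  simp [h, ENNReal.conjExponent]

theorem Exponent.holderConjugate_toReal {x : Ω} (h1 : p x ≠ 1) (h2 : p x ≠ ∞) :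
    (p x).toReal.HolderConjugate (p.conj x).toReal := by
  have h := p.inv_add_inv_conj x
  have hc : p.conj x ≠ ∞ := by
    intro hc
    rw [hc, ENNReal.inv_top, add_zero, ENNReal.inv_eq_one] at h
    exact h1 h
  have hp1 : 1 < (p x).toReal := by
    have := lt_of_le_of_ne (p.one_le x) (Ne.symm h1)
    simpa using (ENNReal.toReal_lt_toReal ENNReal.one_ne_top h2).2 this
  rw [Real.holderConjugate_iff]
  refine ⟨hp1, ?_⟩
  have h0 : p x ≠ 0 := (zero_lt_one.trans_le (p.one_le x)).ne'
  have h0' : p.conj x ≠ 0 := (zero_lt_one.trans_le (p.conj.one_le x)).ne'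
  rw [← ENNReal.toReal_inv, ← ENNReal.toReal_inv, ← ENNReal.toReal_add
    (ENNReal.inv_ne_top.2 h0) (ENNReal.inv_ne_top.2 h0'), h, ENNReal.toReal_one]

theorem Exponent.conj_infSet_subset {x : Ω} (h : x ∈ p.conj.infSet) : p x = 1 := by
  have h' := p.inv_add_inv_conj x
  rw [show p.conj x = ∞ from h, ENNReal.inv_top, add_zero, ENNReal.inv_eq_one] at h'
  exact h'

theorem mul_le_rpow_add_rpow {a b : ℝ≥0∞} {r s : ℝ} (h : r.HolderConjugate s) :
    a * b ≤ a ^ r + b ^ s := by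
  refine (ENNReal.young_inequality a b h).trans (add_le_add ?_ ?_)
  · exact ENNReal.div_le_of_le_mul' (le_mul_of_one_le_left' (by simpa using h.lt.le))
  · exact ENNReal.div_le_of_le_mul' (le_mul_of_one_le_left' (by simpa using h.symm.lt.le))

/-- On {p' = ∞} one has p = 1 and |g| ≤ 1 almost everywhere, so |f g| ≤ |f|^p. Elsewhere Young's
inequality applies, with its factors 1/p and 1/p' bounded by 1. The two pieces of ∫ |f|^p recombine
to the modular of f, and the modular of g contributes the other 1. -/
theorem lintegral_enorm_mul_le_two (hfin : μ p.infSet = 0) {f g : Ω → 𝕜}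
    (hf : AEStronglyMeasurable f μ) (hf1 : modular p μ f ≤ 1) (hg1 : modular p.conj μ g ≤ 1) :
    ∫⁻ x, ‖f x‖ₑ * ‖g x‖ₑ ∂μ ≤ 2 := by
  have hms := p.conj.measurableSet_infSet
  rw [← lintegral_add_compl _ hms]
  have hsup : essSup (fun x => ‖g x‖ₑ) (μ.restrict p.conj.infSet) ≤ 1 := le_add_self.trans hg1
  have hint : ∫⁻ x in p.conj.infSetᶜ, ‖g x‖ₑ ^ (p.conj x).toReal ∂μ ≤ 1 :=
    le_self_add.trans hg1
  have hA : ∫⁻ x in p.conj.infSet, ‖f x‖ₑ * ‖g x‖ₑ ∂μ ≤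
      ∫⁻ x in p.conj.infSet, ‖f x‖ₑ ^ (p x).toReal ∂μ := by
    refine lintegral_mono_ae ?_
    filter_upwards [ENNReal.ae_le_essSup (μ := μ.restrict p.conj.infSet) fun x => ‖g x‖ₑ,
      ae_restrict_mem hms] with x hx hm
    rw [Exponent.conj_infSet_subset hm]
    simpa using mul_le_mul_right (hx.trans hsup) ‖f x‖ₑ
  have hB : ∫⁻ x in p.conj.infSetᶜ, ‖f x‖ₑ * ‖g x‖ₑ ∂μ ≤
      (∫⁻ x in p.conj.infSetᶜ, ‖f x‖ₑ ^ (p x).toReal ∂μ) +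
      ∫⁻ x in p.conj.infSetᶜ, ‖g x‖ₑ ^ (p.conj x).toReal ∂μ := by
    rw [← lintegral_add_left' ((hf.enorm.restrict).pow
      (p.measurable_toFun.ennreal_toReal.aemeasurable))]
    refine lintegral_mono_ae ?_
    filter_upwards [ae_restrict_of_ae (ae_lt_top hfin), ae_restrict_mem hms.compl] with x hx hm
    exact mul_le_rpow_add_rpow
      (Exponent.holderConjugate_toReal (fun h => hm (Exponent.conj_apply_of_eq_one h)) hx.ne)
  calc _ ≤ (∫⁻ x in p.conj.infSet, ‖f x‖ₑ ^ (p x).toReal ∂μ) +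
        ((∫⁻ x in p.conj.infSetᶜ, ‖f x‖ₑ ^ (p x).toReal ∂μ) + 1) := by
        exact add_le_add hA (hB.trans (by gcongr))
    _ = modular p μ f + 1 := by
      rw [← add_assoc, lintegral_add_compl _ hms, modular_eq_lintegral hfin]
    _ ≤ 2 := by
      rw [← one_add_one_eq_two]
      gcongr

theorem lintegral_enorm_mul_le (hfin : μ p.infSet = 0) {f g : Ω → 𝕜}
    (hf : AEStronglyMeasurable f μ) {a b : ℝ}
    (ha : a ∈ luxSet p μ f) (hb : b ∈ luxSet p.conj μ g) :
    ∫⁻ x, ‖f x‖ₑ * ‖g x‖ₑ ∂μ ≤ ENNReal.ofReal (2 * a * b) := by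
  have ha0 := ha.1
  have hb0 := hb.1
  have h := lintegral_enorm_mul_le_two hfin (f := fun x => f x / (a : 𝕜))
    (by simpa only [div_eq_mul_inv] using hf.mul_const ((a : 𝕜)⁻¹)) ha.2 hb.2
  have e : ∀ x, ‖f x‖ₑ * ‖g x‖ₑ =
      ENNReal.ofReal (a * b) * (‖f x / (a : 𝕜)‖ₑ * ‖g x / (b : 𝕜)‖ₑ) := by
    intro x
    rw [enorm_div_ofReal _ ha0, enorm_div_ofReal _ hb0, ← ofReal_norm, ← ofReal_norm,
      ← ENNReal.ofReal_mul (by positivity), ← ENNReal.ofReal_mul (by positivity),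
      ← ENNReal.ofReal_mul (by positivity), ← ENNReal.ofReal_mul (by positivity),
      ← ENNReal.ofReal_mul (by positivity)]
    congr 1
    field_simp
  simp_rw [e]
  rw [lintegral_const_mul' _ _ ENNReal.ofReal_ne_top]
  calc _ ≤ ENNReal.ofReal (a * b) * 2 := by gcongr
    _ = _ := by
      rw [show (2 : ℝ≥0∞) = ENNReal.ofReal 2 by simp, ← ENNReal.ofReal_mul (by positivity)]
      congr 1
      ring

theorem VLp.integrable_mul (hfin : μ p.infSet = 0) (f : VLp 𝕜 p μ) (g : VLp 𝕜 p.conj μ) :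
    Integrable (fun x => f x * g x) μ := by
  refine ⟨f.aestronglyMeasurable.mul g.aestronglyMeasurable, ?_⟩
  obtain ⟨a, ha⟩ := luxSet_nonempty f
  obtain ⟨b, hb⟩ := luxSet_nonempty g
  refine lt_of_le_of_lt ?_ (ENNReal.ofReal_lt_top (r := 2 * a * b))
  simpa only [enorm_mul] using lintegral_enorm_mul_le hfin f.aestronglyMeasurable ha hb

theorem VLp.norm_integral_mul_le (hfin : μ p.infSet = 0) (f : VLp 𝕜 p μ) (g : VLp 𝕜 p.conj μ) :
    ‖∫ x, f x * g x ∂μ‖ ≤ 2 * ‖g‖ * ‖f‖ := by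
  -- Numbers strictly above the Luxemburg norm lie in the defining set, so the estimate is made with
  -- a slack e that then tends to 0.
  have key : ∀ e : ℝ, 0 < e → ‖∫ x, f x * g x ∂μ‖ ≤ 2 * (‖g‖ + e) * (‖f‖ + e) := by
    intro e he
    have h := lintegral_enorm_mul_le hfin f.aestronglyMeasurable
      (f.mem_luxSet_of_norm_lt (lt_add_of_pos_right _ he))
      (g.mem_luxSet_of_norm_lt (lt_add_of_pos_right _ he))
    have h2 := (norm_integral_le_lintegral_norm fun x => f x * g x).trans
      (ENNReal.toReal_mono ENNReal.ofReal_ne_top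
        (by simpa only [ofReal_norm, enorm_mul] using h))
    rw [ENNReal.toReal_ofReal (by positivity)] at h2
    linarith
  have hlim : Filter.Tendsto (fun e : ℝ => 2 * (‖g‖ + e) * (‖f‖ + e)) (nhdsWithin 0 (Set.Ioi 0))
      (nhds (2 * (‖g‖ + 0) * (‖f‖ + 0))) :=
    Filter.Tendsto.mono_left (Continuous.tendsto (by fun_prop) 0) nhdsWithin_le_nhds
  simp only [add_zero] at hlim
  exact ge_of_tendsto hlim (Filter.eventually_of_mem self_mem_nhdsWithin fun e he => key e he)

/-- The pairing `(g, f) ↦ ∫ f g` of `L^{p'(·)}` with `L^{p(·)}`. -/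
def pairing (hfin : μ p.infSet = 0) : VLp 𝕜 p.conj μ →L[𝕜] StrongDual 𝕜 (VLp 𝕜 p μ) :=
  LinearMap.mkContinuous₂
    (LinearMap.mk₂ 𝕜 (fun (g : VLp 𝕜 p.conj μ) (f : VLp 𝕜 p μ) => ∫ x, f x * g x ∂μ)
      (fun g₁ g₂ f => by
        rw [← integral_add (f.integrable_mul hfin g₁) (f.integrable_mul hfin g₂)]
        refine integral_congr_ae ?_
        filter_upwards [VLp.coeFn_add g₁ g₂] with x hx
        rw [hx, mul_add])
      (fun c g f => by
        rw [smul_eq_mul, ← integral_const_mul]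
        refine integral_congr_ae ?_
        filter_upwards [VLp.coeFn_smul c g] with x hx
        rw [hx]
        ring)
      (fun g f₁ f₂ => by
        rw [← integral_add (f₁.integrable_mul hfin g) (f₂.integrable_mul hfin g)]
        refine integral_congr_ae ?_
        filter_upwards [VLp.coeFn_add f₁ f₂] with x hx
        rw [hx, add_mul])
      (fun c g f => by
        rw [smul_eq_mul, ← integral_const_mul]
        refine integral_congr_ae ?_
        filter_upwards [VLp.coeFn_smul c f] with x hx
        rw [hx]
        ring)) 2 fun g f => f.norm_integral_mul_le hfin g

theorem pairing_apply (hfin : μ p.infSet = 0) (g : VLp 𝕜 p.conj μ) (f : VLp 𝕜 p μ) :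
    pairing hfin g f = ∫ x, f x * g x ∂μ := rfl

/-! ### Order continuity of the norm -/

/-- All multiples of `D` have a finite modular. -/
def FiniteModular (p : Exponent Ω) (μ : Measure Ω) (D : Ω → ℝ≥0∞) : Prop :=
  ∀ c : ℝ≥0, ∫⁻ x, ((c : ℝ≥0∞) * D x) ^ (p x).toReal ∂μ < ∞

theorem FiniteModular.const_mul {D : Ω → ℝ≥0∞} (hD : FiniteModular p μ D) (k : ℝ≥0) :
    FiniteModular p μ fun x => (k : ℝ≥0∞) * D x := fun c => by
  simpa only [ENNReal.coe_mul, mul_assoc] using hD (c * k)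

theorem FiniteModular.memVLp (hfin : μ p.infSet = 0) {D : Ω → ℝ≥0∞} (hD : FiniteModular p μ D)
    {f : Ω → 𝕜} (hf : ∀ᵐ x ∂μ, ‖f x‖ₑ ≤ D x) : MemVLp p μ f := by
  refine ⟨1, one_pos, ?_⟩
  rw [modular_eq_lintegral hfin]
  refine lt_of_le_of_lt (lintegral_mono_ae ?_) (hD 1)
  filter_upwards [hf] with x hx
  refine ENNReal.rpow_le_rpow ?_ ENNReal.toReal_nonneg
  simpa using hx

/-- The norm of F i - f is at most ε/2 once the modular of (F i - f)/(ε/2) is at most 1. That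
modular tends to 0 by dominated convergence: its integrand is bounded by (2 (ε/2)⁻¹ D)^p, which is
integrable because every multiple of D has finite modular. -/
theorem VLp.tendsto_of_dominated (hfin : μ p.infSet = 0) {ι : Type*} {l : Filter ι}
    [l.IsCountablyGenerated] {D : Ω → ℝ≥0∞} (hD : FiniteModular p μ D) {F : ι → VLp 𝕜 p μ}
    {f : VLp 𝕜 p μ} (hF : ∀ i, ∀ᵐ x ∂μ, ‖F i x‖ₑ ≤ D x) (hf : ∀ᵐ x ∂μ, ‖f x‖ₑ ≤ D x)
    (hlim : ∀ᵐ x ∂μ, Tendsto (fun i => F i x) l (𝓝 (f x))) : Tendsto F l (𝓝 f) := by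
  rw [tendsto_iff_norm_sub_tendsto_zero, Metric.tendsto_nhds]
  intro ε hε
  have hε2 : 0 < ε / 2 := by linarith
  have hT : Tendsto (fun i => ∫⁻ x, ‖(F i x - f x) / ((ε / 2 : ℝ) : 𝕜)‖ₑ ^ (p x).toReal ∂μ) l
      (𝓝 (∫⁻ _, 0 ∂μ)) := by
    refine tendsto_lintegral_filter_of_dominated_convergence'
      (fun x => (((Real.toNNReal (ε / 2)⁻¹ * 2 : ℝ≥0) : ℝ≥0∞) * D x) ^ (p x).toReal) ?_ ?_
      (hD _).ne ?_
    · refine Eventually.of_forall fun i => ?_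
      have : AEStronglyMeasurable (fun x => (F i x - f x) / ((ε / 2 : ℝ) : 𝕜)) μ := by
        have hs : AEStronglyMeasurable (fun x => F i x - f x) μ :=
          (F i).aestronglyMeasurable.sub f.aestronglyMeasurable
        simpa only [div_eq_mul_inv] using hs.mul_const (((ε / 2 : ℝ) : 𝕜)⁻¹)
      exact this.enorm.pow p.measurable_toFun.ennreal_toReal.aemeasurable
    · refine Eventually.of_forall fun i => ?_
      filter_upwards [hF i, hf] with x h1 h2
      refine ENNReal.rpow_le_rpow ?_ ENNReal.toReal_nonneg
      rw [enorm_div_ofReal _ hε2, ENNReal.coe_mul, mul_assoc]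
      refine mul_le_mul' le_rfl ((enorm_sub_le).trans ?_)
      rw [ENNReal.coe_ofNat, two_mul]
      exact add_le_add h1 h2
    · filter_upwards [hlim, ae_one_le_toReal hfin] with x hx hp
      have h1 : Tendsto (fun i => ‖(F i x - f x) / ((ε / 2 : ℝ) : 𝕜)‖ₑ) l (𝓝 0) := by
        have := ((hx.sub_const (f x)).div_const ((ε / 2 : ℝ) : 𝕜)).enorm
        simpa using this
      have h2 := (ENNReal.continuous_rpow_const (y := (p x).toReal)).tendsto 0
      rw [ENNReal.zero_rpow_of_pos (by linarith)] at h2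
      exact h2.comp h1
  rw [lintegral_zero] at hT
  filter_upwards [hT.eventually_le_const zero_lt_one] with i hi
  have hle : ‖F i - f‖ ≤ ε / 2 := by
    rw [norm_def, luxNorm_congr (VLp.coeFn_sub _ _)]
    exact luxNorm_le_of_mem ⟨hε2, by rwa [modular_eq_lintegral hfin]⟩
  rw [Real.dist_eq, sub_zero, abs_of_nonneg (norm_nonneg _)]
  linarith

/-- With p ≤ N on the support, enlarging a function by a factor K ≥ 1 enlarges its modular by at
most K^N, so finiteness at one scale gives it at every scale. -/
theorem VLpBdd.finiteModular (hfin : μ p.infSet = 0) {f : VLp 𝕜 p μ} (hf : f ∈ VLpBdd 𝕜 p μ) :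
    FiniteModular p μ fun x => ‖f x‖ₑ := by
  intro c
  obtain ⟨l, hl, hm⟩ := luxSet_nonempty f
  rw [modular_eq_lintegral hfin] at hm
  have hP : p.pPlus μ (Function.support f) < ∞ := hf
  set N := (p.pPlus μ (Function.support f)).toReal with hN
  -- The maximum with 1 makes K^p increasing in the exponent, so that K^p ≤ K^N.
  set K : ℝ≥0 := max 1 (c * Real.toNNReal l)
  have hs : ∀ᵐ x ∂μ.restrict (Function.support f), p x ≤ p.pPlus μ (Function.support f) :=
    ENNReal.ae_le_essSup _
  rw [ae_restrict_iff'₀ (show NullMeasurableSet (Function.support f) μ from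
    f.aestronglyMeasurable.aemeasurable.nullMeasurable (measurableSet_singleton 0).compl)] at hs
  have hle : ∀ᵐ x ∂μ, ((c : ℝ≥0∞) * ‖f x‖ₑ) ^ (p x).toReal ≤
      (K : ℝ≥0∞) ^ N * ‖f x / (l : 𝕜)‖ₑ ^ (p x).toReal := by
    filter_upwards [hs, ae_one_le_toReal hfin] with x hx hp
    by_cases h0 : f x = 0
    · simp only [h0, enorm_zero, mul_zero]
      rw [ENNReal.zero_rpow_of_pos (by linarith)]
      exact zero_le
    · have hpN : (p x).toReal ≤ N := ENNReal.toReal_mono hP.ne (hx h0)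
      have h1 : (c : ℝ≥0∞) * ‖f x‖ₑ ≤ (K : ℝ≥0∞) * ‖f x / (l : 𝕜)‖ₑ := by
        have : ‖f x‖ₑ = ENNReal.ofReal l * ‖f x / (l : 𝕜)‖ₑ := by
          rw [enorm_div_ofReal _ hl, ← mul_assoc, ← ENNReal.ofReal_mul hl.le,
            mul_inv_cancel₀ hl.ne', ENNReal.ofReal_one, one_mul]
        rw [this, ← mul_assoc]
        refine mul_le_mul' ?_ le_rfl
        rw [ENNReal.ofReal, ← ENNReal.coe_mul]
        exact ENNReal.coe_le_coe.2 (le_max_right _ _)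
      refine (ENNReal.rpow_le_rpow h1 ENNReal.toReal_nonneg).trans ?_
      rw [ENNReal.mul_rpow_of_nonneg _ _ ENNReal.toReal_nonneg]
      refine mul_le_mul' ?_ le_rfl
      exact ENNReal.rpow_le_rpow_of_exponent_le (by exact_mod_cast le_max_left _ _) hpN
  refine (lintegral_mono_ae hle).trans_lt ?_
  have hK : (K : ℝ≥0∞) ^ N ≠ ∞ := ENNReal.rpow_ne_top_of_nonneg ENNReal.toReal_nonneg
    ENNReal.coe_ne_top
  rw [lintegral_const_mul' _ _ hK]
  exact ENNReal.mul_lt_top hK.lt_top (hm.trans_lt ENNReal.one_lt_top)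

/-- The division by 1 + r absorbs c^r uniformly in r: c / (1 + r) ≤ c / r ≤ exp (c / r), whose r-th
power is exp c. -/
theorem rpow_mul_div_one_add_le {h c r : ℝ} (h0 : 0 ≤ h) (h1 : h ≤ 1) (hc : 0 ≤ c) (hr : 1 ≤ r) :
    (c * (h / (1 + r))) ^ r ≤ Real.exp c * h := by
  have hr0 : 0 < r := by linarith
  have hcr : c / (1 + r) ≤ Real.exp (c / r) := by
    have h2 : c / (1 + r) ≤ c / r := div_le_div_of_nonneg_left hc hr0 (by linarith)
    linarith [Real.add_one_le_exp (c / r)]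
  calc (c * (h / (1 + r))) ^ r = (c / (1 + r) * h) ^ r := by congr 1; ring
    _ = (c / (1 + r)) ^ r * h ^ r := Real.mul_rpow (by positivity) h0
    _ ≤ Real.exp (c / r) ^ r * h ^ (1 : ℝ) := by
        refine mul_le_mul (Real.rpow_le_rpow (by positivity) hcr hr0.le)
          (Real.rpow_le_rpow_of_exponent_ge_of_imp h0 h1 hr (fun _ _ => by linarith))
          (by positivity) (by positivity)
    _ = Real.exp c * h := by
        rw [← Real.exp_mul, Real.rpow_one, div_mul_cancel₀ _ hr0.ne']

/-- There is a strictly positive function all of whose multiples have a finite modular. -/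
theorem exists_pos_finiteModular [SigmaFinite μ] (hfin : μ p.infSet = 0) :
    ∃ w : Ω → ℝ, Measurable w ∧ (∀ x, 0 < w x) ∧ FiniteModular p μ fun x => ‖w x‖ₑ := by
  obtain ⟨h, hpos, hmeas, hint⟩ := exists_pos_lintegral_lt_of_sigmaFinite μ one_ne_zero
  -- The weight is w = min(h, 1) / (1 + p) with h > 0 integrable; the denominator makes (c w)^p ≤
  -- e^c h even where p is unbounded. Where p = ∞, `toReal` gives 0, so w is positive there as well.
  have hw0 : ∀ x, 0 < min (h x : ℝ) 1 / (1 + (p x).toReal) := fun x =>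
    div_pos (lt_min (hpos x) one_pos) (by positivity)
  refine ⟨fun x => min (h x : ℝ) 1 / (1 + (p x).toReal), ?_, hw0, fun c => ?_⟩
  · exact (hmeas.coe_nnreal_real.min measurable_const).div
      (measurable_const.add p.measurable_toFun.ennreal_toReal)
  have hle : ∀ᵐ x ∂μ, ((c : ℝ≥0∞) * ‖min (h x : ℝ) 1 / (1 + (p x).toReal)‖ₑ) ^ (p x).toReal ≤
      ENNReal.ofReal (Real.exp c) * h x := by
    filter_upwards [ae_one_le_toReal hfin] with x hx
    have hb := rpow_mul_div_one_add_le (le_min (h x).coe_nonneg zero_le_one) (min_le_right _ _)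
      c.coe_nonneg hx
    have e1 : (c : ℝ≥0∞) = ENNReal.ofReal c := by simp
    have e2 : (h x : ℝ≥0∞) = ENNReal.ofReal (h x) := by simp
    rw [← ofReal_norm, Real.norm_of_nonneg (hw0 x).le, e1, e2, ← ENNReal.ofReal_mul c.coe_nonneg,
      ← ENNReal.ofReal_mul (Real.exp_pos _).le,
      ENNReal.ofReal_rpow_of_nonneg (mul_nonneg c.coe_nonneg (hw0 x).le) (by linarith)]
    refine ENNReal.ofReal_le_ofReal (hb.trans ?_)
    exact mul_le_mul_of_nonneg_left (min_le_left _ _) (Real.exp_pos _).le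
  refine (lintegral_mono_ae hle).trans_lt ?_
  rw [lintegral_const_mul' _ _ ENNReal.ofReal_ne_top]
  exact ENNReal.mul_lt_top ENNReal.ofReal_lt_top (hint.trans ENNReal.one_lt_top)

/-! ### The norm conjugate formula -/

/-- The functional `φ` is integration against `g` on all functions of `L^{p(·)}_b` that are
dominated by a multiple of the weight `w`. -/
structure RepresentedBy (φ : StrongDual 𝕜 (VLp 𝕜 p μ)) (w : Ω → ℝ) (g : Ω → 𝕜) : Prop where
  measurable : Measurable g
  integrable : Integrable (fun x => (w x : 𝕜) * g x) μ
  apply_eq : ∀ f : VLp 𝕜 p μ, (∃ k : ℕ, ∀ᵐ x ∂μ, ‖f x‖ ≤ k * w x) → f ∈ VLpBdd 𝕜 p μ →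
    φ f = ∫ x, f x * g x ∂μ

theorem mem_VLpBdd_of_le {f : VLp 𝕜 p μ} {n : ℝ≥0} (h : ∀ᵐ x ∂μ, f x ≠ 0 → p x ≤ n) :
    f ∈ VLpBdd 𝕜 p μ := by
  change essSup p (μ.restrict (Function.support f)) < ∞
  refine lt_of_le_of_lt (essSup_le_of_ae_le (n : ℝ≥0∞) ?_) ENNReal.coe_lt_top
  exact (ae_restrict_iff'₀ (show NullMeasurableSet (Function.support f) μ from
    f.aestronglyMeasurable.aemeasurable.nullMeasurable (measurableSet_singleton 0).compl)).2 h

variable {φ : StrongDual 𝕜 (VLp 𝕜 p μ)} {w : Ω → ℝ} {g : Ω → 𝕜}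

theorem ae_enorm_le_of_norm_le (k : ℕ)
    (hw0 : ∀ x, 0 < w x) {f : Ω → 𝕜} (hf : ∀ᵐ x ∂μ, ‖f x‖ ≤ k * w x) :
    ∀ᵐ x ∂μ, ‖f x‖ₑ ≤ ((k : ℝ≥0) : ℝ≥0∞) * ‖w x‖ₑ := by
  filter_upwards [hf] with x hx
  rw [← ofReal_norm, ← ofReal_norm, Real.norm_of_nonneg (hw0 x).le]
  refine (ENNReal.ofReal_le_ofReal hx).trans (le_of_eq ?_)
  rw [ENNReal.ofReal_mul (by positivity)]
  simp

theorem norm_conj_mul_inv_norm_le (z : 𝕜) : ‖(starRingEnd 𝕜) z * ((‖z‖⁻¹ : ℝ) : 𝕜)‖ ≤ 1 := by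
  rw [norm_mul, RCLike.norm_conj, RCLike.norm_ofReal, abs_of_nonneg (by positivity)]
  exact mul_inv_le_one

theorem conj_mul_inv_norm_mul_self (z : 𝕜) :
    (starRingEnd 𝕜) z * ((‖z‖⁻¹ : ℝ) : 𝕜) * z = (‖z‖ : 𝕜) := by
  by_cases h : z = 0
  · simp [h]
  · have h' : (‖z‖ : 𝕜) ≠ 0 := by exact_mod_cast (norm_pos_iff.2 h).ne'
    rw [mul_right_comm, RCLike.conj_mul]
    push_cast
    field_simp

/-- The function b times the conjugate phase of g has absolute value at most b and norm at most a,
and φ takes the value ∫ b |g| on it. The bound by k w and the bound on p where b ≠ 0 place it in the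
class on which φ is represented. A separate M ≥ ‖φ‖ allows M > 0 later even when φ = 0. -/
theorem RepresentedBy.lintegral_mul_le (hfin : μ p.infSet = 0) (hφ : RepresentedBy φ w g)
    (hw : FiniteModular p μ fun x => ‖w x‖ₑ) (hw0 : ∀ x, 0 < w x) {M : ℝ} (hM : ‖φ‖ ≤ M)
    {b : Ω → ℝ} (hb : Measurable b) (hb0 : ∀ x, 0 ≤ b x) {k : ℕ} (hbk : ∀ x, b x ≤ k * w x)
    {n : ℝ≥0} (hbn : ∀ x, b x ≠ 0 → p x ≤ n) {a : ℝ} (ha0 : 0 < a)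
    (ha : ∫⁻ x, ENNReal.ofReal (a⁻¹ * b x) ^ (p x).toReal ∂μ ≤ 1) :
    ∫⁻ x, ENNReal.ofReal (b x) * ‖g x‖ₑ ∂μ ≤ ENNReal.ofReal (M * a) := by
  -- Where g = 0 the inverse norm is 0, so f₀ = 0 there and f₀ g = b |g| still holds.
  set f₀ : Ω → 𝕜 := fun x => (b x : 𝕜) * ((starRingEnd 𝕜) (g x) * ((‖g x‖⁻¹ : ℝ) : 𝕜)) with hf₀
  have hg := hφ.measurable
  have hfm : AEStronglyMeasurable f₀ μ := by
    refine Measurable.aestronglyMeasurable ?_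
    exact (RCLike.measurable_ofReal.comp hb).mul
      ((RCLike.continuous_conj.measurable.comp hg).mul
        (RCLike.measurable_ofReal.comp hg.norm.inv))
  have hfb : ∀ x, ‖f₀ x‖ ≤ b x := fun x => by
    rw [hf₀, norm_mul, RCLike.norm_of_nonneg (hb0 x)]
    exact mul_le_of_le_one_right (hb0 x) (norm_conj_mul_inv_norm_le _)
  have hfw : ∀ᵐ x ∂μ, ‖f₀ x‖ ≤ k * w x := ae_of_all _ fun x => (hfb x).trans (hbk x)
  have hmem : MemVLp p μ f₀ := (hw.const_mul k).memVLp hfin (ae_enorm_le_of_norm_le k hw0 hfw)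
  have hcoe := VLp.coeFn_mk f₀ hfm hmem
  have hlux : a ∈ luxSet p μ f₀ := by
    refine ⟨ha0, ?_⟩
    rw [modular_eq_lintegral hfin]
    refine (lintegral_mono fun x => ENNReal.rpow_le_rpow ?_ ENNReal.toReal_nonneg).trans ha
    rw [enorm_div_ofReal _ ha0, ENNReal.ofReal_mul (by positivity), ← ofReal_norm]
    exact mul_le_mul' le_rfl (ENNReal.ofReal_le_ofReal (hfb x))
  have happ := hφ.apply_eq (VLp.mk f₀ hfm hmem)
    ⟨k, by filter_upwards [hcoe, hfw] with x h1 h2; rwa [h1]⟩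
    (mem_VLpBdd_of_le (n := n) (by
      filter_upwards [hcoe] with x hx h0
      refine hbn x fun hbx => h0 ?_
      rw [hx, hf₀]
      simp [hbx]))
  have hint : ∫ x, VLp.mk f₀ hfm hmem x * g x ∂μ = ((∫ x, b x * ‖g x‖ ∂μ : ℝ) : 𝕜) := by
    rw [← integral_ofReal]
    refine integral_congr_ae ?_
    filter_upwards [hcoe] with x hx
    rw [hx, hf₀]
    simp only
    rw [mul_assoc, conj_mul_inv_norm_mul_self]
    push_cast
    rfl
  have hI : Integrable (fun x => b x * ‖g x‖) μ := by
    refine (hφ.integrable.norm.const_mul (k : ℝ)).mono' (hb.mul hg.norm).aestronglyMeasurable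
      (ae_of_all _ fun x => ?_)
    rw [Real.norm_of_nonneg (mul_nonneg (hb0 x) (norm_nonneg _)), norm_mul,
      RCLike.norm_of_nonneg (hw0 x).le, ← mul_assoc]
    exact mul_le_mul_of_nonneg_right (hbk x) (norm_nonneg _)
  have hI0 : 0 ≤ ∫ x, b x * ‖g x‖ ∂μ :=
    integral_nonneg fun x => mul_nonneg (hb0 x) (norm_nonneg _)
  have hle : ∫ x, b x * ‖g x‖ ∂μ ≤ M * a := by
    have h1 := φ.le_opNorm (VLp.mk f₀ hfm hmem)
    rw [happ, hint, RCLike.norm_of_nonneg hI0] at h1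
    exact h1.trans (mul_le_mul hM (VLp.norm_mk_le hfm hmem hlux) (norm_nonneg _)
      ((norm_nonneg _).trans hM))
  have hconv := ofReal_integral_eq_lintegral_ofReal hI
    (ae_of_all _ fun x => mul_nonneg (hb0 x) (norm_nonneg _))
  refine le_trans (le_of_eq ?_) (ENNReal.ofReal_le_ofReal hle)
  rw [hconv]
  refine lintegral_congr fun x => ?_
  rw [ENNReal.ofReal_mul (hb0 x), ofReal_norm]

theorem lintegral_rpow_lt_top (hw : FiniteModular p μ fun x => ‖w x‖ₑ)
    {b : Ω → ℝ} {k : ℕ} (hbk : ∀ x, b x ≤ k * w x) :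
    ∫⁻ x, ENNReal.ofReal (b x) ^ (p x).toReal ∂μ < ∞ := by
  refine (lintegral_mono fun x => ENNReal.rpow_le_rpow ?_ ENNReal.toReal_nonneg).trans_lt
    (hw k)
  refine (ENNReal.ofReal_le_ofReal (hbk x)).trans ?_
  rw [ENNReal.ofReal_mul (by positivity)]
  refine mul_le_mul' (by simp) ?_
  change _ ≤ ‖w x‖ₑ
  rw [← ofReal_norm]
  exact ENNReal.ofReal_le_ofReal (le_abs_self _)

/-- With I the modular of b, a = 1 + I is admissible in `RepresentedBy.lintegral_mul_le`: since a ≥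
1 and p ≥ 1, (b / a)^p ≤ b^p / a, and I / a ≤ 1. A bound by the modular, unlike one by the norm, can
be absorbed in `RepresentedBy.setLIntegral_le`. -/
theorem RepresentedBy.lintegral_mul_le_one_add (hfin : μ p.infSet = 0)
    (hφ : RepresentedBy φ w g)
    (hw : FiniteModular p μ fun x => ‖w x‖ₑ) (hw0 : ∀ x, 0 < w x) {M : ℝ} (hM : ‖φ‖ ≤ M)
    {b : Ω → ℝ} (hb : Measurable b) (hb0 : ∀ x, 0 ≤ b x) {k : ℕ} (hbk : ∀ x, b x ≤ k * w x)
    {n : ℝ≥0} (hbn : ∀ x, b x ≠ 0 → p x ≤ n) :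
    ∫⁻ x, ENNReal.ofReal (b x) * ‖g x‖ₑ ∂μ ≤
      ENNReal.ofReal M * (1 + ∫⁻ x, ENNReal.ofReal (b x) ^ (p x).toReal ∂μ) := by
  have hI := lintegral_rpow_lt_top hw hbk
  set I := ∫⁻ x, ENNReal.ofReal (b x) ^ (p x).toReal ∂μ with hIdef
  have ha0 : 0 < 1 + I.toReal := by positivity
  have haI : ENNReal.ofReal (1 + I.toReal) = 1 + I := by
    rw [ENNReal.ofReal_add zero_le_one ENNReal.toReal_nonneg, ENNReal.ofReal_one,
      ENNReal.ofReal_toReal hI.ne]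
  rw [← haI, ← ENNReal.ofReal_mul ((norm_nonneg _).trans hM)]
  refine hφ.lintegral_mul_le hfin hw hw0 hM hb hb0 hbk hbn ha0 ?_
  have hle : ∀ᵐ x ∂μ, ENNReal.ofReal ((1 + I.toReal)⁻¹ * b x) ^ (p x).toReal ≤
      ENNReal.ofReal (1 + I.toReal)⁻¹ * ENNReal.ofReal (b x) ^ (p x).toReal := by
    filter_upwards [ae_one_le_toReal hfin] with x hx
    rw [ENNReal.ofReal_mul (by positivity), ENNReal.mul_rpow_of_nonneg _ _ ENNReal.toReal_nonneg]
    refine mul_le_mul' ?_ le_rfl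
    refine ENNReal.rpow_le_self_of_le_one ?_ hx
    rw [← ENNReal.ofReal_one]
    exact ENNReal.ofReal_le_ofReal (inv_le_one_of_one_le₀ (by linarith [I.toReal_nonneg]))
  refine (lintegral_mono_ae hle).trans ?_
  rw [lintegral_const_mul' _ _ ENNReal.ofReal_ne_top, ← hIdef, ENNReal.ofReal_inv_of_pos ha0, haI]
  calc _ ≤ (1 + I)⁻¹ * (1 + I) := mul_le_mul' le_rfl le_add_self
    _ ≤ 1 := ENNReal.inv_mul_le_one _

/-- Where p = 1 the modular is an L¹ norm, so testing with w 1_E gives ∫_E w |g| ≤ M ∫_E w for every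
measurable E in {p = 1}. Hence w |g| ≤ M w almost everywhere there, and w > 0 cancels. -/
theorem RepresentedBy.ae_enorm_le [SigmaFinite μ] (hfin : μ p.infSet = 0)
    (hφ : RepresentedBy φ w g) (hwm : Measurable w)
    (hw : FiniteModular p μ fun x => ‖w x‖ₑ) (hw0 : ∀ x, 0 < w x) {M : ℝ} (hM : ‖φ‖ ≤ M)
    (hM0 : 0 < M) : ∀ᵐ x ∂μ, p x = 1 → ‖g x‖ₑ ≤ ENNReal.ofReal M := by
  have hg := hφ.measurable
  have hP : MeasurableSet {x | p x = 1} := p.measurable_toFun (measurableSet_singleton 1)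
  have key : (fun x => ENNReal.ofReal (w x) * ‖g x‖ₑ) ≤ᵐ[μ.restrict {x | p x = 1}]
      fun x => ENNReal.ofReal M * ENNReal.ofReal (w x) := by
    refine ae_le_of_forall_setLIntegral_le_of_sigmaFinite
      (hwm.ennreal_ofReal.mul hg.enorm) fun s hs _ => ?_
    rw [Measure.restrict_restrict hs]
    set E := s ∩ {x | p x = 1} with hE
    have hEm : MeasurableSet E := hs.inter hP
    set b : Ω → ℝ := E.indicator w with hbdef
    have hb : Measurable b := hwm.indicator hEm
    have hb0 : ∀ x, 0 ≤ b x := fun x => Set.indicator_nonneg (fun y _ => (hw0 y).le) x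
    have hbk : ∀ x, b x ≤ (1 : ℕ) * w x := fun x => by
      rw [Nat.cast_one, one_mul]
      exact Set.indicator_le_self' (fun y _ => (hw0 y).le) x
    have hbE : ∀ x, b x ≠ 0 → p x = 1 := fun x hx => (Set.mem_of_indicator_ne_zero hx).2
    have hpw : ∀ c : ℝ, ∀ᵐ x ∂μ, ENNReal.ofReal (c * b x) ^ (p x).toReal =
        ENNReal.ofReal (c * b x) := fun c => by
      filter_upwards [ae_one_le_toReal hfin] with x hx
      by_cases h : b x = 0
      · rw [h, mul_zero, ENNReal.ofReal_zero, ENNReal.zero_rpow_of_pos (by linarith)]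
      · simp [hbE x h]
    have hIw : ∫⁻ x in E, ENNReal.ofReal (w x) ∂μ = ∫⁻ x, ENNReal.ofReal (b x) ∂μ := by
      rw [← lintegral_indicator hEm]
      refine lintegral_congr fun x => ?_
      by_cases h : x ∈ E <;> simp [hbdef, h]
    have hIg : ∫⁻ x in E, ENNReal.ofReal (w x) * ‖g x‖ₑ ∂μ =
        ∫⁻ x, ENNReal.ofReal (b x) * ‖g x‖ₑ ∂μ := by
      rw [← lintegral_indicator hEm]
      refine lintegral_congr fun x => ?_
      by_cases h : x ∈ E <;> simp [hbdef, h]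
    rw [lintegral_const_mul' _ _ ENNReal.ofReal_ne_top, hIw, hIg]
    have hI : ∫⁻ x, ENNReal.ofReal (b x) ∂μ < ∞ := by
      refine lt_of_eq_of_lt (lintegral_congr_ae ?_) (lintegral_rpow_lt_top hw hbk)
      filter_upwards [hpw 1] with x hx
      simpa only [one_mul] using hx.symm
    set I := ∫⁻ x, ENNReal.ofReal (b x) ∂μ
    refine ENNReal.le_of_forall_pos_le_add fun e he _ => ?_
    have he' : (0 : ℝ) < e := by exact_mod_cast he
    -- The term e / M keeps a positive when the integral vanishes, and costs exactly e after
    -- multiplication by M.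
    have ha0 : 0 < I.toReal + e / M := by positivity
    refine (hφ.lintegral_mul_le hfin hw hw0 hM hb hb0 hbk (n := 1)
      (fun x hx => by simp [hbE x hx]) ha0 ?_).trans (le_of_eq ?_)
    · rw [lintegral_congr_ae (hpw _)]
      simp_rw [ENNReal.ofReal_mul (inv_nonneg.2 ha0.le)]
      rw [lintegral_const_mul' _ _ ENNReal.ofReal_ne_top, ENNReal.ofReal_inv_of_pos ha0]
      refine le_trans (mul_le_mul' le_rfl ?_) (ENNReal.inv_mul_le_one (ENNReal.ofReal (I.toReal + e / M)))
      rw [ENNReal.ofReal_add ENNReal.toReal_nonneg (by positivity), ENNReal.ofReal_toReal hI.ne]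
      exact le_self_add
    · rw [mul_add, mul_div_cancel₀ _ hM0.ne', ENNReal.ofReal_add (by positivity) he'.le,
        ENNReal.ofReal_mul hM0.le, ENNReal.ofReal_toReal hI.ne]
      simp
  filter_upwards [(ae_restrict_iff' hP).1 key] with x hx h1
  have h2 := hx h1
  rw [mul_comm] at h2
  exact (ENNReal.mul_le_mul_iff_left (by simpa using hw0 x) ENNReal.ofReal_ne_top).1 h2

/-- Put h = |g| / (3M) and test with b = h^(p' - 1) on the given set D. Conjugacy gives b^p = h^p'
and b |g| = 3M h^p', so J = ∫_D h^p' satisfies 3J ≤ 1 + J. Since b ≤ n w, J is finite and may be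
subtracted, leaving J ≤ 1/2. The conditions defining D make p' finite, p bounded and b dominated by
the weight. -/
theorem RepresentedBy.setLIntegral_le (hfin : μ p.infSet = 0)
    (hφ : RepresentedBy φ w g) (hwm : Measurable w)
    (hw : FiniteModular p μ fun x => ‖w x‖ₑ) (hw0 : ∀ x, 0 < w x) {M : ℝ} (hM : ‖φ‖ ≤ M)
    (hM0 : 0 < M) (n : ℕ) :
    ∫⁻ x in {x | p x ≠ 1 ∧ p x ≤ n ∧
        (‖g x‖ / (3 * M)) ^ ((p.conj x).toReal - 1) ≤ n * w x},
      ENNReal.ofReal (‖g x‖ / (3 * M)) ^ (p.conj x).toReal ∂μ ≤ 2⁻¹ := by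
  have hg := hφ.measurable
  have hpm := p.measurable_toFun
  have hqm := p.conj.measurable_toFun.ennreal_toReal
  set h : Ω → ℝ := fun x => ‖g x‖ / (3 * M) with hh
  have hhm : Measurable h := hg.norm.div_const _
  have hh0 : ∀ x, 0 ≤ h x := fun x => by positivity
  set D := {x | p x ≠ 1 ∧ p x ≤ n ∧ h x ^ ((p.conj x).toReal - 1) ≤ n * w x} with hD
  have hDm : MeasurableSet D :=
    (hpm (measurableSet_singleton 1)).compl.inter ((measurableSet_le hpm measurable_const).inter
      (measurableSet_le (hhm.pow (hqm.sub_const 1)) (hwm.const_mul _)))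
  set b : Ω → ℝ := D.indicator fun x => h x ^ ((p.conj x).toReal - 1) with hbdef
  have hb : Measurable b := (hhm.pow (hqm.sub_const 1)).indicator hDm
  have hb0 : ∀ x, 0 ≤ b x := fun x => Set.indicator_nonneg (fun y _ => by positivity) x
  have hbk : ∀ x, b x ≤ n * w x := fun x => by
    by_cases hx : x ∈ D
    · rw [hbdef, Set.indicator_of_mem hx]
      exact hx.2.2
    · rw [hbdef, Set.indicator_of_notMem hx]
      exact mul_nonneg (by positivity) (hw0 x).le
  have hbD : ∀ x, b x ≠ 0 → x ∈ D := fun x hx => Set.mem_of_indicator_ne_zero hx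
  have hconj : ∀ x ∈ D, (p x).toReal.HolderConjugate (p.conj x).toReal := fun x hx =>
    Exponent.holderConjugate_toReal hx.1 (ne_top_of_le_ne_top (ENNReal.natCast_ne_top n) hx.2.1)
  have hpow : ∫⁻ x, ENNReal.ofReal (b x) ^ (p x).toReal ∂μ =
      ∫⁻ x in D, ENNReal.ofReal (h x) ^ (p.conj x).toReal ∂μ := by
    rw [← lintegral_indicator hDm]
    refine lintegral_congr_ae ?_
    filter_upwards [ae_one_le_toReal hfin] with x hx
    by_cases hxD : x ∈ D
    · have hc := hconj x hxD
      simp only [hbdef, Set.indicator_of_mem hxD]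
      rw [← ENNReal.ofReal_rpow_of_nonneg (hh0 x) hc.symm.sub_one_pos.le, ← ENNReal.rpow_mul,
        hc.symm.sub_one_mul_conj]
    · simp only [hbdef, Set.indicator_of_notMem hxD]
      rw [ENNReal.ofReal_zero, ENNReal.zero_rpow_of_pos (by linarith)]
  have hmul : ∫⁻ x, ENNReal.ofReal (b x) * ‖g x‖ₑ ∂μ = ENNReal.ofReal M *
      (3 * ∫⁻ x in D, ENNReal.ofReal (h x) ^ (p.conj x).toReal ∂μ) := by
    rw [← lintegral_const_mul' _ _ (by simp), ← lintegral_const_mul' _ _ ENNReal.ofReal_ne_top,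
      ← lintegral_indicator hDm]
    refine lintegral_congr fun x => ?_
    by_cases hxD : x ∈ D
    · have hc := hconj x hxD
      simp only [hbdef, Set.indicator_of_mem hxD]
      rw [← ofReal_norm, ENNReal.ofReal_rpow_of_nonneg (hh0 x) hc.symm.nonneg,
        ← ENNReal.ofReal_mul (by positivity), show (3 : ℝ≥0∞) = ENNReal.ofReal 3 by simp,
        ← ENNReal.ofReal_mul (by positivity), ← ENNReal.ofReal_mul (by positivity)]
      congr 1
      have hgh : ‖g x‖ = 3 * M * h x := by
        rw [hh]
        field_simp
      have hp1 : h x ^ (p.conj x).toReal = h x ^ ((p.conj x).toReal - 1) * h x := by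
        have := Real.rpow_add_of_nonneg (hh0 x) hc.symm.sub_one_pos.le zero_le_one
        rwa [sub_add_cancel, Real.rpow_one] at this
      rw [hgh, hp1]
      ring
    · simp [hbdef, hxD]
  have hlt := lintegral_rpow_lt_top hw hbk
  have hT := hφ.lintegral_mul_le_one_add hfin hw hw0 hM hb hb0 hbk (n := n)
    (fun x hx => by simpa using (hbD x hx).2.1)
  rw [hpow] at hlt hT
  rw [hmul, ENNReal.mul_le_mul_iff_right (by simpa using hM0) ENNReal.ofReal_ne_top] at hT
  set J := ∫⁻ x in D, ENNReal.ofReal (h x) ^ (p.conj x).toReal ∂μ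
  have hJ : 2 * J ≤ 1 := by
    have h3 : 3 * J = 2 * J + J := by ring
    rw [h3] at hT
    exact (ENNReal.add_le_add_iff_right hlt.ne).1 hT
  rw [← one_div]
  exact (ENNReal.le_div_iff_mul_le (by simp) (by simp)).2 (by rwa [mul_comm])

/-- The modular of g / (3M) has two parts, each at most 1/2. The integral over {p' < ∞} is the limit
of those in `RepresentedBy.setLIntegral_le`; on {p' = ∞}, where p = 1, the bound |g| ≤ M gives 1/3.
-/
theorem RepresentedBy.mem_luxSet [SigmaFinite μ] (hfin : μ p.infSet = 0)
    (hφ : RepresentedBy φ w g) (hwm : Measurable w)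
    (hw : FiniteModular p μ fun x => ‖w x‖ₑ) (hw0 : ∀ x, 0 < w x) {M : ℝ} (hM : ‖φ‖ ≤ M)
    (hM0 : 0 < M) : 3 * M ∈ luxSet p.conj μ g := by
  have h3 : 0 < 3 * M := by positivity
  have hen : ∀ x, ‖g x / ((3 * M : ℝ) : 𝕜)‖ₑ = ENNReal.ofReal (‖g x‖ / (3 * M)) := fun x => by
    rw [← ofReal_norm, norm_div, RCLike.norm_of_nonneg h3.le]
  refine ⟨h3, ?_⟩
  have hA : ∫⁻ x in p.conj.infSetᶜ, ‖g x / ((3 * M : ℝ) : 𝕜)‖ₑ ^ (p.conj x).toReal ∂μ ≤ 2⁻¹ := by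
    simp_rw [hen]
    set D : ℕ → Set Ω := fun n => {x | p x ≠ 1 ∧ p x ≤ n ∧
      (‖g x‖ / (3 * M)) ^ ((p.conj x).toReal - 1) ≤ n * w x} with hD
    have hmono : Monotone D := fun m n hmn x hx =>
      ⟨hx.1, hx.2.1.trans (by exact_mod_cast hmn), hx.2.2.trans
        (mul_le_mul_of_nonneg_right (by exact_mod_cast hmn) (hw0 x).le)⟩
    -- The inclusion holds only up to a null set: where p = ∞ the dual exponent is 1, hence finite,
    -- but no n bounds p.
    have hsub : (p.conj.infSetᶜ : Set Ω) ≤ᵐ[μ] (⋃ n, D n : Set Ω) := by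
      filter_upwards [ae_lt_top hfin] with x hx hxc
      obtain ⟨n, hn⟩ := ENNReal.exists_nat_gt hx.ne
      obtain ⟨m, hm⟩ := exists_nat_ge
        ((‖g x‖ / (3 * M)) ^ ((p.conj x).toReal - 1) / w x)
      rw [div_le_iff₀ (hw0 x)] at hm
      refine Set.mem_iUnion.2 ⟨max n m, fun h => hxc (Exponent.conj_apply_of_eq_one h),
        hn.le.trans (by exact_mod_cast le_max_left _ _), hm.trans ?_⟩
      exact mul_le_mul_of_nonneg_right (by exact_mod_cast le_max_right _ _) (hw0 x).le
    refine (lintegral_mono' (Measure.restrict_mono_ae hsub) le_rfl).trans ?_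
    rw [setLIntegral_iUnion_of_directed _ hmono.directed_le]
    exact iSup_le fun n => hφ.setLIntegral_le hfin hwm hw hw0 hM hM0 n
  have hB : essSup (fun x => ‖g x / ((3 * M : ℝ) : 𝕜)‖ₑ) (μ.restrict p.conj.infSet) ≤ 2⁻¹ := by
    refine essSup_le_of_ae_le _ ?_
    filter_upwards [ae_restrict_of_ae (hφ.ae_enorm_le hfin hwm hw hw0 hM hM0),
      ae_restrict_mem p.conj.measurableSet_infSet] with x hx hm
    have h1 := hx (Exponent.conj_infSet_subset hm)
    rw [enorm_div_ofReal _ h3]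
    refine (mul_le_mul' le_rfl h1).trans ?_
    rw [← ENNReal.ofReal_mul (by positivity), show (2⁻¹ : ℝ≥0∞) = ENNReal.ofReal 2⁻¹ by
      rw [ENNReal.ofReal_inv_of_pos two_pos]; simp]
    refine ENNReal.ofReal_le_ofReal ?_
    rw [mul_inv, mul_assoc, inv_mul_cancel₀ hM0.ne']
    norm_num
  exact (add_le_add hA hB).trans (ENNReal.inv_two_add_inv_two).le

/-! ### Representation of functionals -/

theorem memVLp_of_norm_le (hfin : μ p.infSet = 0) (hw : FiniteModular p μ fun x => ‖w x‖ₑ)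
    (hw0 : ∀ x, 0 < w x) (k : ℕ) {f : Ω → 𝕜} (hf : ∀ᵐ x ∂μ, ‖f x‖ ≤ k * w x) : MemVLp p μ f :=
  (hw.const_mul k).memVLp hfin (ae_enorm_le_of_norm_le k hw0 hf)

theorem norm_indicator_weight_le {Ω : Type*} {w : Ω → ℝ} (hw0 : ∀ x, 0 < w x) (E : Set Ω)
    (x : Ω) :
    ‖E.indicator (fun x => (w x : 𝕜)) x‖ ≤ (1 : ℕ) * w x := by
  rw [Nat.cast_one, one_mul]
  refine (norm_indicator_le_norm_self _ _).trans (le_of_eq ?_)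
  exact RCLike.norm_of_nonneg (hw0 x).le

theorem measurable_indicator_weight (hwm : Measurable w) {E : Set Ω} (hE : MeasurableSet E) :
    Measurable (E.indicator fun x => (w x : 𝕜)) :=
  (RCLike.measurable_ofReal.comp hwm).indicator hE

/-- The set function `E ↦ φ (w 1_E)` as a vector measure. -/
def functionalMeasure (hfin : μ p.infSet = 0) (φ : StrongDual 𝕜 (VLp 𝕜 p μ))
    (hwm : Measurable w) (hw : FiniteModular p μ fun x => ‖w x‖ₑ) (hw0 : ∀ x, 0 < w x) :
    VectorMeasure Ω 𝕜 :=
  open scoped Classical in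
  { measureOf' := fun E => if hE : MeasurableSet E then
      φ (VLp.mk (E.indicator fun x => (w x : 𝕜))
        (measurable_indicator_weight hwm hE).aestronglyMeasurable
        (memVLp_of_norm_le hfin hw hw0 1 (ae_of_all _ (norm_indicator_weight_le hw0 E)))) else 0
    empty' := by
      rw [dif_pos MeasurableSet.empty]
      convert map_zero φ
      refine VLp.ext ((VLp.coeFn_mk _ _ _).trans ?_)
      filter_upwards [VLp.coeFn_zero (𝕜 := 𝕜) (p := p) (μ := μ)] with x hx
      simp [hx]
    not_measurable' := fun E hE => dif_neg hE
    m_iUnion' := fun E hE hdisj => by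
      simp only [hE, MeasurableSet.iUnion hE, dif_pos]
      -- By continuity of φ, countable additivity reduces to norm convergence of the sum of the w
      -- 1_{E i}, which is dominated by w.
      refine (ContinuousLinearMap.hasSum φ (?_ : HasSum (fun i => VLp.mk _ _ _) _))
      rw [HasSum]
      -- One null set serves all finite partial sums, since there are countably many finite sets of
      -- indices.
      have hcoe : ∀ᵐ x ∂μ, ∀ s : Finset ℕ, (∑ i ∈ s, VLp.mk ((E i).indicator fun x => (w x : 𝕜))
          (measurable_indicator_weight hwm (hE i)).aestronglyMeasurable
          (memVLp_of_norm_le hfin hw hw0 1 (ae_of_all _ (norm_indicator_weight_le hw0 (E i)))) :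
            VLp 𝕜 p μ) x = (⋃ i ∈ s, E i).indicator (fun x => (w x : 𝕜)) x := by
        rw [ae_all_iff]
        intro s
        induction s using Finset.induction_on with
        | empty =>
          filter_upwards [VLp.coeFn_zero (𝕜 := 𝕜) (p := p) (μ := μ)] with x hx
          simpa using hx
        | insert a s ha ih =>
          rw [Finset.sum_insert ha]
          refine (VLp.coeFn_add _ _).trans ?_
          filter_upwards [ih, VLp.coeFn_mk ((E a).indicator fun x => (w x : 𝕜))
            (measurable_indicator_weight hwm (hE a)).aestronglyMeasurable
            (memVLp_of_norm_le hfin hw hw0 1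
              (ae_of_all _ (norm_indicator_weight_le hw0 (E a))))] with x h1 h2
          rw [h1, h2, Finset.set_biUnion_insert, Set.indicator_union_of_disjoint]
          refine Set.disjoint_iUnion₂_right.2 fun i hi => hdisj ?_
          rintro rfl
          exact ha hi
      have hlim := VLp.coeFn_mk ((⋃ i, E i).indicator fun x => (w x : 𝕜))
        (measurable_indicator_weight hwm (MeasurableSet.iUnion hE)).aestronglyMeasurable
        (memVLp_of_norm_le hfin hw hw0 1
          (ae_of_all _ (norm_indicator_weight_le hw0 (⋃ i, E i))))
      refine VLp.tendsto_of_dominated hfin (hw.const_mul (1 : ℕ)) (fun s => ?_) ?_ ?_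
      · refine ae_enorm_le_of_norm_le 1 hw0 ?_
        filter_upwards [hcoe] with x hx
        rw [hx s]
        exact norm_indicator_weight_le hw0 _ x
      · refine ae_enorm_le_of_norm_le 1 hw0 ?_
        filter_upwards [hlim] with x hx
        rw [hx]
        exact norm_indicator_weight_le hw0 _ x
      · filter_upwards [hcoe, hlim] with x h1 h2
        simp only [h1, h2]
        exact (tendsto_indicator_biUnion_finset E _ x).mono_right (pure_le_nhds _) }

theorem functionalMeasure_apply (hfin : μ p.infSet = 0) (φ : StrongDual 𝕜 (VLp 𝕜 p μ))
    (hwm : Measurable w) (hw : FiniteModular p μ fun x => ‖w x‖ₑ) (hw0 : ∀ x, 0 < w x)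
    {E : Set Ω} (hE : MeasurableSet E) {f : VLp 𝕜 p μ}
    (hf : f =ᵐ[μ] E.indicator fun x => (w x : 𝕜)) :
    functionalMeasure hfin φ hwm hw hw0 E = φ f := by
  refine (dif_pos hE).trans (congrArg φ (VLp.ext ?_))
  exact (VLp.coeFn_mk _ _ _).trans hf.symm

/-- A Radon-Nikodym theorem for vector measures with values in `𝕜`. -/
theorem exists_integrable_setIntegral_eq [SigmaFinite μ] (ν : VectorMeasure Ω 𝕜)
    (hν : ∀ E, MeasurableSet E → μ E = 0 → ν E = 0) :
    ∃ G : Ω → 𝕜, Measurable G ∧ Integrable G μ ∧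
      ∀ E, MeasurableSet E → ν E = ∫ x in E, G x ∂μ := by
  -- Real and imaginary parts of ν are signed measures; each has a real density, and the two
  -- recombine.
  have key : ∀ (L : 𝕜 →+ ℝ) (hL : Continuous L), ∃ r : Ω → ℝ, Measurable r ∧ Integrable r μ ∧
      ∀ E, MeasurableSet E → L (ν E) = ∫ x in E, r x ∂μ := by
    intro L hL
    set s : SignedMeasure Ω := ν.mapRange L hL with hs
    have hac : s ≪ᵥ μ.toENNRealVectorMeasure := by
      refine VectorMeasure.AbsolutelyContinuous.mk fun E hE h0 => ?_
      rw [Measure.toENNRealVectorMeasure_apply_measurable hE] at h0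
      rw [hs, VectorMeasure.mapRange_apply, hν E hE h0, map_zero]
    refine ⟨s.rnDeriv μ, SignedMeasure.measurable_rnDeriv s μ,
      SignedMeasure.integrable_rnDeriv s μ, fun E hE => ?_⟩
    rw [← withDensityᵥ_apply (SignedMeasure.integrable_rnDeriv s μ) hE,
      SignedMeasure.withDensityᵥ_rnDeriv_eq s μ hac, hs, VectorMeasure.mapRange_apply]
  obtain ⟨r, hrm, hri, hr⟩ := key RCLike.re RCLike.continuous_re
  obtain ⟨i, him, hii, hi⟩ := key RCLike.im RCLike.continuous_im
  refine ⟨fun x => (r x : 𝕜) + (i x : 𝕜) * RCLike.I,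
    (RCLike.measurable_ofReal.comp hrm).add ((RCLike.measurable_ofReal.comp him).mul_const _),
    hri.ofReal.add (hii.ofReal.mul_const _), fun E hE => ?_⟩
  have hadd := integral_add (μ := μ.restrict E) (hri.ofReal (𝕜 := 𝕜)).restrict
    ((hii.ofReal (𝕜 := 𝕜)).mul_const RCLike.I).restrict
  rw [integral_mul_const, integral_ofReal, integral_ofReal, ← hr E hE, ← hi E hE] at hadd
  exact (RCLike.re_add_im _).symm.trans hadd.symm

/-- Linearity extends the formula from w 1_E to w s. The integrand is grouped as (w g) s because w g
is integrable and s is bounded, whereas g alone need not be integrable. -/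
theorem apply_eq_integral_of_simpleFunc (hfin : μ p.infSet = 0)
    (hwm : Measurable w) (hw : FiniteModular p μ fun x => ‖w x‖ₑ) (hw0 : ∀ x, 0 < w x)
    (hwg : Integrable (fun x => (w x : 𝕜) * g x) μ)
    (hφ : ∀ (E : Set Ω) (f : VLp 𝕜 p μ), MeasurableSet E →
      f =ᵐ[μ] E.indicator (fun x => (w x : 𝕜)) → φ f = ∫ x in E, w x * g x ∂μ)
    (s : SimpleFunc Ω 𝕜) : ∀ f : VLp 𝕜 p μ, f =ᵐ[μ] (fun x => (w x : 𝕜) * s x) →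
      φ f = ∫ x, (w x * g x) * s x ∂μ := by
  have hmem : ∀ (s : SimpleFunc Ω 𝕜), ∃ f : VLp 𝕜 p μ, f =ᵐ[μ] fun x => (w x : 𝕜) * s x := by
    intro s
    obtain ⟨C, hC⟩ := s.exists_forall_norm_le
    obtain ⟨k, hk⟩ := exists_nat_ge C
    refine ⟨VLp.mk (fun x => (w x : 𝕜) * s x)
      ((RCLike.measurable_ofReal.comp hwm).mul s.measurable).aestronglyMeasurable
      (memVLp_of_norm_le hfin hw hw0 k (ae_of_all _ fun x => ?_)), VLp.coeFn_mk _ _ _⟩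
    rw [norm_mul, RCLike.norm_of_nonneg (hw0 x).le, mul_comm]
    exact mul_le_mul_of_nonneg_right ((hC x).trans hk) (hw0 x).le
  have hint : ∀ s : SimpleFunc Ω 𝕜, Integrable (fun x => ((w x : 𝕜) * g x) * s x) μ := by
    intro s
    obtain ⟨C, hC⟩ := s.exists_forall_norm_le
    exact hwg.mul_bdd s.aestronglyMeasurable (ae_of_all _ hC)
  induction s using SimpleFunc.induction with
  | const c hE =>
    rename_i E
    intro f hf
    obtain ⟨f₁, hf₁⟩ := hmem (SimpleFunc.piecewise E hE (SimpleFunc.const Ω 1)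
      (SimpleFunc.const Ω 0))
    have hf₁' : f₁ =ᵐ[μ] E.indicator (fun x => (w x : 𝕜)) := by
      filter_upwards [hf₁] with x hx
      rw [hx]
      by_cases h : x ∈ E <;> simp [h]
    have hff : f = c • f₁ := by
      refine VLp.ext ?_
      filter_upwards [hf, hf₁', VLp.coeFn_smul c f₁] with x h1 h2 h3
      rw [h1, h3, h2]
      by_cases h : x ∈ E <;> simp [h, mul_comm]
    rw [hff, map_smul, hφ E f₁ hE hf₁', smul_eq_mul, ← integral_const_mul,
      ← integral_indicator hE]
    refine integral_congr_ae (ae_of_all _ fun x => ?_)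
    by_cases h : x ∈ E <;> simp [h, mul_comm]
  | @add s t hdisj hs ht =>
    intro f hf
    obtain ⟨f₁, hf₁⟩ := hmem s
    obtain ⟨f₂, hf₂⟩ := hmem t
    have hff : f = f₁ + f₂ := by
      refine VLp.ext ?_
      filter_upwards [hf, hf₁, hf₂, VLp.coeFn_add f₁ f₂] with x h1 h2 h3 h4
      rw [h1, h4, h2, h3, SimpleFunc.coe_add, Pi.add_apply, mul_add]
    rw [hff, map_add, hs f₁ hf₁, ht f₂ hf₂, ← integral_add (hint s) (hint t)]
    refine integral_congr_ae (ae_of_all _ fun x => ?_)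
    simp [mul_add]

/-- The quotient f / w is bounded by k, hence an almost everywhere limit of simple functions s n
with the same bound. Then w s n tends to f in norm, dominated by k w, while the integrals converge
with dominating function k |w g|. -/
theorem apply_eq_integral_of_norm_le (hfin : μ p.infSet = 0)
    (hwm : Measurable w) (hw : FiniteModular p μ fun x => ‖w x‖ₑ) (hw0 : ∀ x, 0 < w x)
    (hwg : Integrable (fun x => (w x : 𝕜) * g x) μ)
    (hφ : ∀ (E : Set Ω) (f : VLp 𝕜 p μ), MeasurableSet E →
      f =ᵐ[μ] E.indicator (fun x => (w x : 𝕜)) → φ f = ∫ x in E, w x * g x ∂μ)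
    (f : VLp 𝕜 p μ) {k : ℕ} (hf : ∀ᵐ x ∂μ, ‖f x‖ ≤ k * w x) : φ f = ∫ x, f x * g x ∂μ := by
  have hwne : ∀ x, (w x : 𝕜) ≠ 0 := fun x => by exact_mod_cast (hw0 x).ne'
  have hbm : AEStronglyMeasurable (fun x => f x * ((w x : 𝕜))⁻¹) μ :=
    f.aestronglyMeasurable.mul
      (RCLike.measurable_ofReal.comp hwm).inv.aestronglyMeasurable
  set b := hbm.mk _
  have hb : StronglyMeasurable b := hbm.stronglyMeasurable_mk
  have hfb : f =ᵐ[μ] fun x => (w x : 𝕜) * b x := by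
    filter_upwards [hbm.ae_eq_mk] with x hx
    change f x * ((w x : 𝕜))⁻¹ = b x at hx
    rw [← hx, mul_comm, inv_mul_cancel_right₀ (hwne x)]
  have hbk : ∀ᵐ x ∂μ, ‖b x‖ ≤ k := by
    filter_upwards [hf, hfb] with x h1 h2
    rw [h2, norm_mul, RCLike.norm_of_nonneg (hw0 x).le, mul_comm] at h1
    exact le_of_mul_le_mul_right h1 (hw0 x)
  set s : ℕ → SimpleFunc Ω 𝕜 := hb.approxBounded k
  have hs : ∀ n x, ‖s n x‖ ≤ k := fun n x => hb.norm_approxBounded_le (Nat.cast_nonneg k) n x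
  have hslim : ∀ᵐ x ∂μ, Tendsto (fun n => s n x) atTop (𝓝 (b x)) :=
    hb.tendsto_approxBounded_ae hbk
  have hsw : ∀ n x, ‖(w x : 𝕜) * s n x‖ ≤ k * w x := fun n x => by
    rw [norm_mul, RCLike.norm_of_nonneg (hw0 x).le, mul_comm]
    exact mul_le_mul_of_nonneg_right (hs n x) (hw0 x).le
  set F : ℕ → VLp 𝕜 p μ := fun n => VLp.mk (fun x => (w x : 𝕜) * s n x)
    ((RCLike.measurable_ofReal.comp hwm).mul (s n).measurable).aestronglyMeasurable
    (memVLp_of_norm_le hfin hw hw0 k (ae_of_all _ (hsw n)))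
  have hF : ∀ n, F n =ᵐ[μ] fun x => (w x : 𝕜) * s n x := fun n => VLp.coeFn_mk _ _ _
  have hFlim : Tendsto F atTop (𝓝 f) := by
    refine VLp.tendsto_of_dominated hfin (hw.const_mul k) (fun n => ?_)
      (ae_enorm_le_of_norm_le k hw0 hf) ?_
    · refine ae_enorm_le_of_norm_le k hw0 ?_
      filter_upwards [hF n] with x hx
      rw [hx]
      exact hsw n x
    · filter_upwards [ae_all_iff.2 hF, hfb, hslim] with x h1 h2 h3
      simp only [h1, h2]
      exact h3.const_mul _
  have h1 : Tendsto (fun n => φ (F n)) atTop (𝓝 (φ f)) := (φ.continuous.tendsto f).comp hFlim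
  have h2 : Tendsto (fun n => φ (F n)) atTop (𝓝 (∫ x, f x * g x ∂μ)) := by
    have e : ∀ n, φ (F n) = ∫ x, ((w x : 𝕜) * g x) * s n x ∂μ := fun n =>
      apply_eq_integral_of_simpleFunc hfin hwm hw hw0 hwg hφ (s n) (F n) (hF n)
    simp_rw [e]
    refine tendsto_integral_of_dominated_convergence (fun x => ‖(w x : 𝕜) * g x‖ * k)
      (fun n => hwg.aestronglyMeasurable.mul (s n).aestronglyMeasurable) (hwg.norm.mul_const _)
      (fun n => ae_of_all _ fun x => ?_) ?_
    · rw [norm_mul]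
      exact mul_le_mul_of_nonneg_left (hs n x) (norm_nonneg _)
    · filter_upwards [hfb, hslim] with x h1 h2
      rw [h1, mul_right_comm]
      exact h2.const_mul _
  exact tendsto_nhds_unique h1 h2

theorem exists_representedBy [SigmaFinite μ] (hfin : μ p.infSet = 0)
    (hwm : Measurable w) (hw : FiniteModular p μ fun x => ‖w x‖ₑ) (hw0 : ∀ x, 0 < w x)
    (φ : StrongDual 𝕜 (VLp 𝕜 p μ)) :
    ∃ g : Ω → 𝕜, RepresentedBy φ w g := by
  obtain ⟨G, hGm, hGi, hG⟩ := exists_integrable_setIntegral_eq (μ := μ)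
    (functionalMeasure hfin φ hwm hw hw0) fun E hE h0 => by
      rw [functionalMeasure_apply hfin φ hwm hw hw0 hE (f := 0), map_zero]
      filter_upwards [VLp.coeFn_zero (𝕜 := 𝕜) (p := p) (μ := μ),
        measure_eq_zero_iff_ae_notMem.1 h0] with x h1 h2
      rw [h1, Set.indicator_of_notMem h2]
  have hwne : ∀ x, (w x : 𝕜) ≠ 0 := fun x => by exact_mod_cast (hw0 x).ne'
  have hwG : ∀ x, (w x : 𝕜) * (G x * (w x : 𝕜)⁻¹) = G x := fun x => by
    rw [mul_comm, inv_mul_cancel_right₀ (hwne x)]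
  have hwGi : Integrable (fun x => (w x : 𝕜) * (G x * (w x : 𝕜)⁻¹)) μ := by simpa only [hwG]
  -- G is the density of E ↦ φ(w 1_E), so the weight has to be divided out.
  refine ⟨fun x => G x * (w x : 𝕜)⁻¹, hGm.mul (RCLike.measurable_ofReal.comp hwm).inv, hwGi, ?_⟩
  rintro f ⟨k, hk⟩ -
  refine apply_eq_integral_of_norm_le hfin hwm hw hw0 hwGi (fun E f hE hf => ?_) f hk
  simp_rw [hwG]
  rw [← hG E hE, functionalMeasure_apply hfin φ hwm hw hw0 hE hf]

/-- A functional on `L^{p(·)}` agrees on the closure of `L^{p(·)}_b` with integration against a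
function of `L^{p'(·)}`. -/
theorem exists_pairing_eq [SigmaFinite μ] (hfin : μ p.infSet = 0)
    (φ : StrongDual 𝕜 (VLp 𝕜 p μ)) :
    ∃ g : VLp 𝕜 p.conj μ, ∀ f ∈ (VLpBdd 𝕜 p μ).topologicalClosure, φ f = pairing hfin g f := by
  obtain ⟨w, hwm, hw0, hw⟩ := exists_pos_finiteModular (p := p) (μ := μ) hfin
  obtain ⟨g, hg⟩ := exists_representedBy hfin hwm hw hw0 φ
  -- Only membership in `L^{p'(·)}` is needed here, so any positive bound above ‖φ‖ serves.
  have hmem := hg.mem_luxSet hfin hwm hw hw0 (le_add_of_nonneg_right zero_le_one)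
    (by positivity : 0 < ‖φ‖ + 1)
  have hgm := hg.measurable.aestronglyMeasurable (μ := μ)
  have hgX : MemVLp p.conj μ g := (memVLp_iff hgm).2 ⟨_, hmem⟩
  refine ⟨VLp.mk g hgm hgX, ?_⟩
  have hcl : IsClosed {f : VLp 𝕜 p μ | φ f = pairing hfin (VLp.mk g hgm hgX) f} :=
    isClosed_eq φ.continuous (ContinuousLinearMap.continuous _)
  intro f hf
  refine closure_minimal (fun f hf => ?_) hcl hf
  -- Since |f| is itself an admissible dominating function, the truncations of f to {|f| ≤ k w}
  -- converge to f in norm. They stay in `L^{p(·)}_b` and are dominated by k w, so the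
  -- representation applies to each.
  have hfm : FiniteModular p μ fun x => ‖f x‖ₑ := VLpBdd.finiteModular hfin hf
  have hA : ∀ k : ℕ, NullMeasurableSet {x | ‖f x‖ ≤ k * w x} μ := fun k =>
    nullMeasurableSet_le f.aestronglyMeasurable.norm.aemeasurable
      (hwm.const_mul _).aemeasurable
  have hle : ∀ (k : ℕ) x, ‖{x | ‖f x‖ ≤ k * w x}.indicator f x‖ₑ ≤ ‖f x‖ₑ := fun k x =>
    enorm_indicator_le_enorm_self _ _
  set F : ℕ → VLp 𝕜 p μ := fun k => VLp.mk ({x | ‖f x‖ ≤ k * w x}.indicator f)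
    (f.aestronglyMeasurable.indicator₀ (hA k)) (hfm.memVLp hfin (ae_of_all _ (hle k)))
  have hF : ∀ k, F k =ᵐ[μ] {x | ‖f x‖ ≤ k * w x}.indicator f := fun k => VLp.coeFn_mk _ _ _
  have hFlim : Tendsto F atTop (𝓝 f) := by
    refine VLp.tendsto_of_dominated hfin hfm (fun k => ?_) (ae_of_all _ fun x => le_rfl) ?_
    · filter_upwards [hF k] with x hx
      rw [hx]
      exact hle k x
    · filter_upwards [ae_all_iff.2 hF] with x hx
      simp only [hx]
      refine tendsto_const_nhds.congr' ?_
      obtain ⟨k, hk⟩ := exists_nat_ge (‖f x‖ / w x)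
      rw [div_le_iff₀ (hw0 x)] at hk
      filter_upwards [eventually_ge_atTop k] with n hn
      rw [Set.indicator_of_mem]
      exact hk.trans (mul_le_mul_of_nonneg_right (by exact_mod_cast hn) (hw0 x).le)
  refine hcl.mem_of_tendsto hFlim (Eventually.of_forall fun k => ?_)
  have hFb : F k ∈ VLpBdd 𝕜 p μ := by
    refine lt_of_le_of_lt ?_ (show p.pPlus μ (Function.support f) < ∞ from hf)
    refine essSup_mono_measure' (Measure.restrict_mono_ae ?_)
    filter_upwards [hF k] with x hx h0 hfx
    refine h0 (hx.trans ?_)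
    by_cases h : x ∈ {x | ‖f x‖ ≤ k * w x}
    · rw [Set.indicator_of_mem h]
      exact hfx
    · rw [Set.indicator_of_notMem h]
  rw [Set.mem_ofPred_eq, pairing_apply, hg.apply_eq (F k) ⟨k, ?_⟩ hFb]
  · refine integral_congr_ae ?_
    filter_upwards [VLp.coeFn_mk g hgm hgX] with x hx
    rw [hx]
  · filter_upwards [hF k] with x hx
    rw [hx]
    by_cases h : x ∈ {x | ‖f x‖ ≤ k * w x}
    · rw [Set.indicator_of_mem h]
      exact h
    · rw [Set.indicator_of_notMem h, norm_zero]
      exact mul_nonneg (Nat.cast_nonneg k) (hw0 x).le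

/-- The norm of a function of `L^{p'(·)}` is controlled by that of any functional that agrees on
`L^{p(·)}_b` with integration against it. -/
theorem norm_le_of_pairing_eq [SigmaFinite μ] (hfin : μ p.infSet = 0)
    (φ : StrongDual 𝕜 (VLp 𝕜 p μ)) (g : VLp 𝕜 p.conj μ)
    (h : ∀ f ∈ VLpBdd 𝕜 p μ, φ f = pairing hfin g f) : ‖g‖ ≤ 3 * ‖φ‖ := by
  obtain ⟨w, hwm, hw0, hw⟩ := exists_pos_finiteModular (p := p) (μ := μ) hfin
  have hwX : MemVLp p μ (Set.univ.indicator fun x => (w x : 𝕜)) :=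
    memVLp_of_norm_le hfin hw hw0 1 (ae_of_all _ (norm_indicator_weight_le hw0 _))
  have hwmeas := (measurable_indicator_weight (𝕜 := 𝕜) hwm
    MeasurableSet.univ).aestronglyMeasurable (μ := μ)
  -- Agreement is known on `L^{p(·)}_b` alone, which is why `RepresentedBy` restricts its class of
  -- functions to it. Integrability of w g is Hölder's inequality, as w itself lies in `L^{p(·)}`.
  have hrep : RepresentedBy φ w g :=
    { measurable := (AEEqFun.stronglyMeasurable g.toAEEqFun).measurable
      integrable := by
        refine ((VLp.mk _ hwmeas hwX).integrable_mul hfin g).congr ?_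
        filter_upwards [VLp.coeFn_mk _ hwmeas hwX] with x hx
        rw [hx, Set.indicator_univ]
      apply_eq := fun f _ hf => h f hf }
  refine le_of_forall_pos_le_add fun e he => ?_
  -- The slack e / 3 makes M positive even when φ = 0 and becomes e in 3M.
  have hm := hrep.mem_luxSet hfin hwm hw hw0 (M := ‖φ‖ + e / 3)
    (le_add_of_nonneg_right (by positivity)) (by positivity)
  have h1 : ‖g‖ ≤ 3 * (‖φ‖ + e / 3) := luxNorm_le_of_mem hm
  linarith

/-! ### The isomorphism with the direct sum -/

/-- The map `(g, ψ) ↦ (f ↦ ∫ f g + ψ [f])`. -/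
def dualMap (hfin : μ p.infSet = 0) :
    (VLp 𝕜 p.conj μ × StrongDual 𝕜 (Germ 𝕜 p μ)) →L[𝕜] StrongDual 𝕜 (VLp 𝕜 p μ) :=
  (pairing hfin).coprod
    (ContinuousLinearMap.precomp 𝕜 (VLpBdd 𝕜 p μ).topologicalClosure.mkQL)

theorem dualMap_apply (hfin : μ p.infSet = 0) (g : VLp 𝕜 p.conj μ)
    (ψ : StrongDual 𝕜 (Germ 𝕜 p μ)) :
    dualMap hfin (g, ψ) =
      pairing hfin g + ψ.comp (VLpBdd 𝕜 p μ).topologicalClosure.mkQL := rfl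

theorem dualMap_apply_of_mem (hfin : μ p.infSet = 0) (g : VLp 𝕜 p.conj μ)
    (ψ : StrongDual 𝕜 (Germ 𝕜 p μ)) {f : VLp 𝕜 p μ} (hf : f ∈ VLpBdd 𝕜 p μ) :
    dualMap hfin (g, ψ) f = pairing hfin g f := by
  have h0 : (VLpBdd 𝕜 p μ).topologicalClosure.mkQL f = 0 :=
    (Submodule.Quotient.mk_eq_zero _).2 (Submodule.le_topologicalClosure _ hf)
  rw [dualMap_apply, add_apply, ContinuousLinearMap.comp_apply, h0, map_zero,
    add_zero]

/-- Each class has representatives whose norm exceeds the quotient norm by less than any given e >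
0. -/
theorem norm_le_norm_comp_mkQL (S : Submodule 𝕜 (VLp 𝕜 p μ)) (ψ : StrongDual 𝕜 (VLp 𝕜 p μ ⧸ S)) :
    ‖ψ‖ ≤ ‖ψ.comp S.mkQL‖ := by
  refine ψ.opNorm_le_bound (norm_nonneg _) fun x => ?_
  have key : ∀ e : ℝ, 0 < e → ‖ψ x‖ ≤ ‖ψ.comp S.mkQL‖ * (‖x‖ + e) := fun e he => by
    obtain ⟨m, rfl, hm⟩ := Submodule.Quotient.norm_mk_lt x he
    exact ((ψ.comp S.mkQL).le_opNorm m).trans (mul_le_mul_of_nonneg_left hm.le (norm_nonneg _))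
  have hlim : Tendsto (fun e : ℝ => ‖ψ.comp S.mkQL‖ * (‖x‖ + e)) (𝓝[>] 0)
      (𝓝 (‖ψ.comp S.mkQL‖ * (‖x‖ + 0))) :=
    Tendsto.mono_left (Continuous.tendsto (by fun_prop) 0) nhdsWithin_le_nhds
  rw [add_zero] at hlim
  exact ge_of_tendsto hlim (eventually_of_mem self_mem_nhdsWithin key)

theorem exists_norm_le_dualMap [SigmaFinite μ] (hfin : μ p.infSet = 0) :
    ∃ C : ℝ, ∀ z : VLp 𝕜 p.conj μ × StrongDual 𝕜 (Germ 𝕜 p μ),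
      ‖z.1‖ ≤ C * ‖dualMap hfin z‖ ∧ ‖z.2‖ ≤ C * ‖dualMap hfin z‖ := by
  -- With T the assembled functional and P the pairing, ‖g‖ ≤ 3‖T‖ because T agrees with integration
  -- against g on `L^{p(·)}_b`. The germ part is T - P g, so ‖ψ‖ ≤ (1 + 3‖P‖)‖T‖. The constant
  -- exceeds both.
  refine ⟨3 + 3 * ‖pairing (𝕜 := 𝕜) hfin‖, fun ⟨g, ψ⟩ => ?_⟩
  have hg : ‖g‖ ≤ 3 * ‖dualMap hfin (g, ψ)‖ :=
    norm_le_of_pairing_eq hfin _ g fun f hf => dualMap_apply_of_mem hfin g ψ hf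
  have hψ : ‖ψ‖ ≤ ‖dualMap hfin (g, ψ)‖ + ‖pairing (𝕜 := 𝕜) hfin‖ * ‖g‖ := by
    refine (norm_le_norm_comp_mkQL _ ψ).trans ?_
    have he : ψ.comp (VLpBdd 𝕜 p μ).topologicalClosure.mkQL =
        dualMap hfin (g, ψ) - pairing hfin g := by
      rw [dualMap_apply, add_sub_cancel_left]
    rw [he]
    exact (norm_sub_le _ _).trans (add_le_add le_rfl (ContinuousLinearMap.le_opNorm _ g))
  have hP := norm_nonneg (pairing (𝕜 := 𝕜) (p := p) (μ := μ) hfin)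
  have hT := norm_nonneg (dualMap hfin (g, ψ))
  have hPg := mul_le_mul_of_nonneg_left hg hP
  refine ⟨?_, ?_⟩
  · change ‖g‖ ≤ _
    nlinarith
  · change ‖ψ‖ ≤ _
    nlinarith

/-- Subtracting from φ the integral that represents it on the closure of `L^{p(·)}_b` leaves a
functional that vanishes there, hence one on the germ space. -/
theorem dualMap_surjective [SigmaFinite μ] (hfin : μ p.infSet = 0) :
    Function.Surjective (dualMap (𝕜 := 𝕜) hfin) := by
  intro φ
  obtain ⟨g, hg⟩ := exists_pairing_eq hfin φ
  refine ⟨(g, (VLpBdd 𝕜 p μ).topologicalClosure.liftQL (φ - pairing hfin g) fun f hf => ?_), ?_⟩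
  · exact sub_eq_zero.2 (hg f hf)
  · rw [dualMap_apply]
    ext f
    exact add_sub_cancel (pairing hfin g f) (φ f)

end VarLp

end

theorem theorem2p1 {𝕜 : Type*} [RCLike 𝕜] {Ω : Type*} [MeasurableSpace Ω]
    (μ : MeasureTheory.Measure Ω) [MeasureTheory.SigmaFinite μ] (p : VarLp.Exponent Ω)
    (hfin : μ p.infSet = 0) (hp : p.pPlus μ Set.univ = ∞) :
    Nonempty (StrongDual 𝕜 (VarLp.VLp 𝕜 p μ) ≃L[𝕜]
      (VarLp.VLp 𝕜 p.conj μ × StrongDual 𝕜 (VarLp.Germ 𝕜 p μ))) := by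
  obtain ⟨C, hC⟩ := VarLp.exists_norm_le_dualMap (𝕜 := 𝕜) (p := p) hfin
  have hinj : Function.Injective (VarLp.dualMap (𝕜 := 𝕜) (p := p) hfin) := by
    refine (injective_iff_map_eq_zero _).2 fun z hz => ?_
    have h := hC z
    rw [hz, norm_zero, mul_zero] at h
    have h1 : z.1 = 0 := norm_le_zero_iff.1 h.1
    have h2 : z.2 = 0 := by
      refine ContinuousLinearMap.ext fun x => norm_le_zero_iff.1 ?_
      simpa using (z.2.le_opNorm x).trans (mul_le_mul_of_nonneg_right h.2 (norm_nonneg x))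
    exact Prod.ext h1 h2
  let e := LinearEquiv.ofBijective (VarLp.dualMap (𝕜 := 𝕜) (p := p) hfin).toLinearMap
    ⟨hinj, VarLp.dualMap_surjective hfin⟩
  have he : ∀ φ, VarLp.dualMap hfin (e.symm φ) = φ := e.apply_symm_apply
  -- Continuity of the inverse is read off from the lower bound for `VarLp.dualMap`, one component
  -- at a time, so neither completeness nor the open mapping theorem enters.
  have h1 : Continuous fun φ => (e.symm φ).1 :=
    AddMonoidHomClass.continuous_of_bound (LinearMap.fst 𝕜 _ _ ∘ₗ e.symm.toLinearMap) C
      fun φ => (hC (e.symm φ)).1.trans_eq (congrArg (fun ψ => C * ‖ψ‖) (he φ))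
  have h2 : Continuous fun φ => (e.symm φ).2 :=
    AddMonoidHomClass.continuous_of_bound (LinearMap.snd 𝕜 _ _ ∘ₗ e.symm.toLinearMap) C
      fun φ => (hC (e.symm φ)).2.trans_eq (congrArg (fun ψ => C * ‖ψ‖) (he φ))
  exact ⟨{ e.symm with
    continuous_toFun := h1.prodMk h2
    continuous_invFun := (VarLp.dualMap (𝕜 := 𝕜) (p := p) hfin).continuous }⟩
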